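/- Conventions. In a rooted tree, or in a forest of rooted trees, whose vertices are labeled by $[n]=\{1,\dots,n\}$, a vertex $w$ is a descendant of $v$ if the path from a root to $w$ passes through $v$ (so $v$ is a descendant of itself), and $\beta(v)$ is the smallest descendant of $v$. A plane tree is a rooted tree in which the children of every vertex are linearly ordered from left to right. A vertex $j$ is elder if some sibling $k$ to the right of $j$ (a child of the same parent) satisfies $\beta(k)<\beta(j)$; roots have no siblings and are never elder. An edge $(i,j)$ from $i$ to its child $j$ is proper if $j$ is elder or $i<\beta(j)$, and improper otherwise. For a forest $F$ of plane trees, $\mathrm{eld}(F)$ is the number of its elder vertices. The polynomials $Q_n(x,y,z,t)$, $n\ge 1$, are defined by $$Q_1=1,\qquad Q_{n+1}=\bigl[x+nz+(y+t)(n+y\,\partial_y)\bigr]Q_n ,$$ and $Q_{n,k}(x,t)$ is the coefficient of $y^k$ in $Q_n(x,y,1,t)$. Theorem. Let $n$, $r$, $k$ be integers with $0\le r<n$ and $k\ge 0$, and let $\mathcal F^r_{n,k}$ be the set of forests of $r$ plane trees on $[n]$ with roots $1,\dots,r$ and with $k$ improper edges. Then, as polynomials in $t$, $$r\,Q_{n-r,k}(r,t)=\sum_{F\in\mathcal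 F^r_{n,k}}t^{\mathrm{eld}(F)} .$$ -/

import Mathlib

open Polynomial

/-- The polynomials `Q_n(x, y, z, t)`, with the variables `x, y, z, t` numbered `0, 1, 2, 3`:
`Q_1 = 1` and `Q_{n+1} = [x + n z + (y + t) (n + y ∂_y)] Q_n` for `n ≥ 1`.
(The index starts at `1`; the value at `0` is a placeholder.) -/
noncomputable def chapotonQ : ℕ → MvPolynomial (Fin 4) ℤ
  | 0 => 0
  | 1 => 1
  | n + 2 =>
    (MvPolynomial.X 0 + ((n + 1 : ℕ) : MvPolynomial (Fin 4) ℤ) * MvPolynomial.X 2)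
        * chapotonQ (n + 1)
      + (MvPolynomial.X 1 + MvPolynomial.X 3)
        * (((n + 1 : ℕ) : MvPolynomial (Fin 4) ℤ) * chapotonQ (n + 1)
          + MvPolynomial.X 1 * MvPolynomial.pderiv 1 (chapotonQ (n + 1)))

/-- `Q_{n,k}(x, t)`, the coefficient of `y ^ k` in `Q_n(x, y, 1, t)`; here `x` and `t` are the
variables `0` and `1` of the coefficient ring, and `y` is the polynomial variable over it. -/
noncomputable def chapotonQCoeff (n k : ℕ) : MvPolynomial (Fin 2) ℤ :=
  (MvPolynomial.aeval
    (![C (MvPolynomial.X 0), X, 1, C (MvPolynomial.X 1)] :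
      Fin 4 → Polynomial (MvPolynomial (Fin 2) ℤ))
    (chapotonQ n)).coeff k

/-- A forest of (labeled, rooted) plane trees with vertex set `V`, for a finite type `V`:
each vertex carries the list of its children from left to right, without repetition; a vertex
is a child of at most one vertex; and there is no directed cycle. -/
@[ext]
structure PlaneForest (V : Type) where
  /-- the children of a vertex, listed from left to right -/
  children : V → List V
  nodup : ∀ v, (children v).Nodup
  parent_unique : ∀ u v w, w ∈ children u → w ∈ children v → u = v
  acyclic : ∀ v, ¬ Relation.TransGen (fun u w => w ∈ children u) v v

namespace PlaneForest

noncomputable instance {V : Type} [Fintype V] : Fintype (PlaneForest V) := by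
  classical
  exact Fintype.ofInjective
    (fun F : PlaneForest V => fun v => (⟨F.children v, F.nodup v⟩ : {l : List V // l.Nodup}))
    (fun F G h => PlaneForest.ext (funext fun v => congrArg Subtype.val (congrFun h v)))

/-- A root is a vertex that is the child of no vertex. -/
def IsRoot {V : Type} (F : PlaneForest V) (v : V) : Prop :=
  ∀ u, v ∉ F.children u

/-- `w` is a descendant of `v` (each vertex is a descendant of itself). -/
def IsDescendant {V : Type} (F : PlaneForest V) (v w : V) : Prop :=
  Relation.ReflTransGen (fun a b => b ∈ F.children a) v w

open Classical in
/-- `β_F(v)`, the smallest descendant of `v`. -/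
noncomputable def beta {V : Type} [Fintype V] [LinearOrder V] (F : PlaneForest V) (v : V) : V :=
  (Finset.univ.filter fun w => F.IsDescendant v w).min'
    ⟨v, Finset.mem_filter.2 ⟨Finset.mem_univ v, Relation.ReflTransGen.refl⟩⟩

/-- `j` is elder if it has a brother `k` to its right with `β(k) < β(j)`. Since the list of
children of `i` has no repetition, `[j, k]` is a sublist of it exactly if `j` and `k` are
children of `i` and `k` is to the right of `j`. -/
def IsElder {V : Type} [Fintype V] [LinearOrder V] (F : PlaneForest V) (j : V) : Prop :=
  ∃ i k, [j, k].Sublist (F.children i) ∧ F.beta k < F.beta j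

/-- The number of elder vertices. -/
noncomputable def eld {V : Type} [Fintype V] [LinearOrder V] (F : PlaneForest V) : ℕ :=
  Set.ncard {j | F.IsElder j}

/-- The edge `(i, j)`, from `i` to its child `j`, is proper if `j` is elder or `i < β(j)`;
otherwise it is improper. -/
def IsImproperEdge {V : Type} [Fintype V] [LinearOrder V] (F : PlaneForest V) (i j : V) : Prop :=
  j ∈ F.children i ∧ ¬ (F.IsElder j ∨ i < F.beta j)

/-- The number of improper edges. -/
noncomputable def imp {V : Type} [Fintype V] [LinearOrder V] (F : PlaneForest V) : ℕ :=
  Set.ncard {e : V × V | F.IsImproperEdge e.1 e.2}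

end PlaneForest

open Classical in
/-- The set of forests of `r` plane trees on `[n]` with `k` improper edges and with roots
`1, …, r`. The label `i ∈ [n] = {1, …, n}` is the element `i - 1` of `Fin n`. -/
noncomputable def planeForests (n r k : ℕ) : Finset (PlaneForest (Fin n)) :=
  Finset.univ.filter fun F => (∀ v : Fin n, F.IsRoot v ↔ (v : ℕ) < r) ∧ F.imp = k

/-! Build a forest by adding its vertices in increasing order and track the weight `t^eld * y^imp`.
Let `B` be the current vertex set, `A` its set of non-roots, and let `N` be a new non-root vertex
larger than all of `B`. The enlarged forests are sorted by the children of `N`, and each class is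
compared with the forests on `B`.

If `N` is a leaf, it was inserted into one of the child lists. As `β(N) = N` is maximal, the last
slot of a list changes no statistic, and any other slot makes `N` elder; the factor is `|B| + t|A|`
(`sum_forestWeight_leaf`). If `N` has a single child `i`, it subdivides the edge above `i`, which
adds one improper edge: `y|A|` (`sum_forestsOn_single`, `forestWeight_subdivide`).

If the last two children `j, i` of `N` satisfy `β(j) < β(i)`, give `j` and everything to its left
back to `i`, in front of the children of `i`. Then `N` has the single child `i`, the edge `(i, j)`
is improper, and the weight is unchanged. Conversely, every improper edge leaving `i` arises in this
way, so the factor is `y * imp` (`sum_forestWeight_increasing`). If the last two children are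
decreasing in `β`, exchanging them trades an improper edge for an elder vertex: `t * imp`
(`sum_forestWeight_decreasing`).

The total is `|B| + (y + t)(|A| + imp)`. Since `y ∂_y` multiplies `y^imp` by `imp`, this is the
recursion of `Q_n` at `x = r`, `z = 1`, with `|A| = n` and `|B| = r + n` (`forestPoly_succ`). The
first non-root can be attached to any of the `r` roots, which gives the initial value `r = r * Q_1`.
-/

set_option linter.unusedSectionVars false

/-! ### Forests as families of child lists, and smallest descendants. -/

section ChildLists

variable {V : Type} [Fintype V] [LinearOrder V]

open Classical in
/-- The smallest descendant of `v`, for the parent-child relation given by `c`. -/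
noncomputable def minDesc (c : V → List V) (v : V) : V :=
  (Finset.univ.filter fun w => Relation.ReflTransGen (fun a b => b ∈ c a) v w).min'
    ⟨v, Finset.mem_filter.2 ⟨Finset.mem_univ v, Relation.ReflTransGen.refl⟩⟩

theorem PlaneForest.beta_eq_minDesc (F : PlaneForest V) : F.beta = minDesc F.children := rfl

/-- The recursion that characterizes `minDesc c`. -/
structure IsMinDesc (c : V → List V) (b : V → V) : Prop where
  le_self : ∀ v, b v ≤ v
  le_child : ∀ v, ∀ w ∈ c v, b v ≤ b w
  eq_or : ∀ v, b v = v ∨ ∃ w ∈ c v, b v = b w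

theorem minDesc_le {c : V → List V} {v w : V}
    (h : Relation.ReflTransGen (fun a b => b ∈ c a) v w) : minDesc c v ≤ w := by
  classical
  exact Finset.min'_le _ _ (Finset.mem_filter.2 ⟨Finset.mem_univ _, h⟩)

theorem minDesc_desc (c : V → List V) (v : V) :
    Relation.ReflTransGen (fun a b => b ∈ c a) v (minDesc c v) := by
  classical
  have := Finset.min'_mem (Finset.univ.filter fun w =>
    Relation.ReflTransGen (fun a b => b ∈ c a) v w)
    ⟨v, Finset.mem_filter.2 ⟨Finset.mem_univ v, Relation.ReflTransGen.refl⟩⟩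
  exact (Finset.mem_filter.1 this).2

theorem isMinDesc_minDesc (c : V → List V) : IsMinDesc c (minDesc c) where
  le_self v := minDesc_le .refl
  le_child v w hw := minDesc_le (.head hw (minDesc_desc c w))
  eq_or v := by
    rcases (minDesc_desc c v).cases_head with h | ⟨w, hw, h⟩
    · exact .inl h.symm
    · exact .inr ⟨w, hw, le_antisymm (minDesc_le (.head hw (minDesc_desc c w))) (minDesc_le h)⟩

/-- Acyclicity is essential: on a cycle the recursion has several solutions. Induction on the rank
shows that `b v` is attained at a descendant of `v`. This reduces computing `β` after each surgery
to three local checks. -/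
theorem IsMinDesc.eq_minDesc {c : V → List V} {b : V → V} (hb : IsMinDesc c b)
    (hc : ∃ h : V → ℕ, ∀ u, ∀ w ∈ c u, h w < h u) : b = minDesc c := by
  obtain ⟨h, hh⟩ := hc
  have key : ∀ k, ∀ v, h v = k → Relation.ReflTransGen (fun a b => b ∈ c a) v (b v) := by
    intro k
    induction k using Nat.strong_induction_on with
    | _ k ih =>
      intro v hv
      rcases hb.eq_or v with h1 | ⟨w, hw, h1⟩
      · rw [h1]
      · rw [h1]
        exact .head hw (ih (h w) (hv ▸ hh v w hw) w rfl)
  have low : ∀ v w, Relation.ReflTransGen (fun a b => b ∈ c a) v w → b v ≤ w := by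
    intro v w hvw
    refine le_trans ?_ (hb.le_self w)
    induction hvw with
    | refl => exact le_rfl
    | tail _ h2 ih => exact ih.trans (hb.le_child _ _ h2)
  funext v
  exact le_antisymm (low v _ (minDesc_desc c v)) (minDesc_le (key _ v rfl))

/-- `c` lists the children in a plane forest with vertex set `B`, in which the vertices other
than the roots are the elements of `A`. -/
structure IsForestOn (B A : Finset V) (c : V → List V) : Prop where
  sum_eq : ∑ v, (c v : Multiset V) = A.val
  ranked : ∃ h : V → ℕ, ∀ u, ∀ w ∈ c u, h w < h u
  leaf : ∀ v, v ∉ B → c v = []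

namespace IsForestOn

variable {B A : Finset V} {c : V → List V}

theorem coe_le (hc : IsForestOn B A c) (v : V) : (c v : Multiset V) ≤ A.val := by
  rw [← hc.sum_eq]
  exact Finset.single_le_sum (f := fun v => (c v : Multiset V)) (fun _ _ => zero_le)
    (Finset.mem_univ v)

theorem nodup (hc : IsForestOn B A c) (v : V) : (c v).Nodup :=
  Multiset.coe_nodup.1 (Multiset.nodup_of_le (hc.coe_le v) A.nodup)

theorem mem (hc : IsForestOn B A c) {v w : V} (h : w ∈ c v) : w ∈ A :=
  Multiset.mem_of_le (hc.coe_le v) (Multiset.mem_coe.2 h)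

theorem exists_parent (hc : IsForestOn B A c) {w : V} (h : w ∈ A) : ∃ v, w ∈ c v := by
  have : w ∈ ∑ v, (c v : Multiset V) := by rw [hc.sum_eq]; exact h
  obtain ⟨v, _, hv⟩ := Multiset.mem_sum.1 this
  exact ⟨v, hv⟩

theorem unique (hc : IsForestOn B A c) {u v w : V} (hu : w ∈ c u) (hv : w ∈ c v) : u = v := by
  by_contra huv
  have h1 : (c u : Multiset V) + (c v : Multiset V) ≤ A.val := by
    rw [← hc.sum_eq, ← Finset.sum_pair (f := fun v => (c v : Multiset V)) huv]
    exact Finset.sum_le_sum_of_subset (Finset.subset_univ _)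
  have h2 := Multiset.nodup_of_le h1 A.nodup
  exact (Multiset.disjoint_left.1 (Multiset.nodup_add.1 h2).2.2) hu hv

theorem sum_length (hc : IsForestOn B A c) : ∑ v, (c v).length = A.card := by
  rw [Finset.card_def, ← hc.sum_eq, Multiset.card_sum]
  simp

theorem ne_of_mem (hc : IsForestOn B A c) {u w : V} (h : w ∈ c u) : w ≠ u := by
  obtain ⟨f, hf⟩ := hc.ranked
  rintro rfl
  exact lt_irrefl _ (hf _ _ h)

theorem eq_minDesc (hc : IsForestOn B A c) {b : V → V} (hb : IsMinDesc c b) : minDesc c = b :=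
  (hb.eq_minDesc hc.ranked).symm

/-- Parents are unique, so two vertices with a common descendant are comparable; siblings are not,
because the rank drops along edges. Hence comparisons of `β` between siblings are strict. -/
theorem minDesc_ne (hc : IsForestOn B A c) {u j k : V} (hj : j ∈ c u) (hk : k ∈ c u)
    (hjk : j ≠ k) : minDesc c j ≠ minDesc c k := by
  intro heq
  obtain ⟨f, hf⟩ := hc.ranked
  have mono : ∀ a b, Relation.ReflTransGen (fun a b => b ∈ c a) a b → f b ≤ f a := by
    intro a b h
    induction h with
    | refl => exact le_rfl
    | tail _ h2 ih => exact (hf _ _ h2).le.trans ih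
  have aux : ∀ j k, j ∈ c u → k ∈ c u → j ≠ k →
      ¬ Relation.ReflTransGen (fun a b => b ∈ c a) j k := by
    intro j k hj hk hjk h
    rcases h.cases_tail with h | ⟨w, h1, h2⟩
    · exact hjk h.symm
    · obtain rfl := hc.unique h2 hk
      exact absurd (mono _ _ h1) (not_le.2 (hf _ _ hj))
  have h1 := (Relation.reflTransGen_swap (r := fun a b => b ∈ c a)).2 (minDesc_desc c j)
  have h2 := (Relation.reflTransGen_swap (r := fun a b => b ∈ c a)).2 (minDesc_desc c k)
  rw [← heq] at h2
  rcases Relation.ReflTransGen.total_of_right_unique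
    (r := Function.swap fun a b => b ∈ c a) (fun a b d h h' => hc.unique h h') h1 h2 with h | h
  · exact aux k j hk hj hjk.symm (Relation.reflTransGen_swap.1 h)
  · exact aux j k hj hk hjk (Relation.reflTransGen_swap.1 h)

theorem minDesc_mem (hc : IsForestOn B A c) {v : V} (hv : v ∈ A) : minDesc c v ∈ A := by
  rcases (minDesc_desc c v).cases_tail with h | ⟨w, _, h⟩
  · rwa [h]
  · exact hc.mem h

end IsForestOn

/-! ### Weights of lists of `β`-values. -/

/-- The number of entries `a` of a list with a smaller entry to the right of `a`. -/
def elderCount : List V → ℕ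
  | [] => 0
  | a :: L => (if ∃ k ∈ L, k < a then 1 else 0) + elderCount L

/-- The number of entries `a ≤ v` of a list without a smaller entry to the right of `a`. -/
def improperCount (v : V) : List V → ℕ
  | [] => 0
  | a :: L => (if (∃ k ∈ L, k < a) ∨ v < a then 0 else 1) + improperCount v L

variable {R : Type*} [CommSemiring R]

/-- The monomial that records the elder and the improper entries of a list. -/
def listWeight (y t : R) (v : V) (L : List V) : R := t ^ elderCount L * y ^ improperCount v L

/-- The weight of a forest, given by its lists of children. -/
noncomputable def forestWeight (y t : R) (c : V → List V) : R :=
  ∏ v, listWeight y t v ((c v).map (minDesc c))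

@[simp] theorem listWeight_nil (y t : R) (v : V) : listWeight y t v [] = 1 := by
  simp [listWeight, elderCount, improperCount]

theorem listWeight_cons (y t : R) (v a : V) (L : List V) :
    listWeight y t v (a :: L) =
      (if ∃ k ∈ L, k < a then t else if v < a then 1 else y) * listWeight y t v L := by
  simp only [listWeight, elderCount, improperCount]
  by_cases h1 : ∃ k ∈ L, k < a <;> by_cases h2 : v < a <;>
    simp only [h1, h2, if_true, if_false, or_true, true_or, or_self, pow_add] <;> ring

theorem listWeight_append_max (y t : R) {v N : V} (hv : v < N) (L : List V)
    (hL : ∀ a ∈ L, a ≤ N) : listWeight y t v (L ++ [N]) = listWeight y t v L := by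
  induction L with
  | nil => simp [listWeight_cons, hv]
  | cons a L ih =>
    have ha := hL a (by simp)
    simp only [List.cons_append, listWeight_cons, ih (fun x hx => hL x (by simp [hx]))]
    have : (∃ k ∈ L ++ [N], k < a) ↔ ∃ k ∈ L, k < a := by
      simp only [List.mem_append, List.mem_singleton]
      constructor
      · rintro ⟨k, hk | rfl, hka⟩
        · exact ⟨k, hk, hka⟩
        · exact absurd hka (not_lt.2 ha)
      · rintro ⟨k, hk, hka⟩
        exact ⟨k, .inl hk, hka⟩
    simp only [this]

/-- No other entry changes status: wherever `a` witnesses that an entry to its left is elder, the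
smaller `c` does so as well. -/
theorem listWeight_insert_elder (y t : R) (v : V) {a c : V} (L₁ L₂ : List V) (hca : c ∈ L₂)
    (hlt : c < a) :
    listWeight y t v (L₁ ++ a :: L₂) = t * listWeight y t v (L₁ ++ L₂) := by
  induction L₁ with
  | nil =>
    simp only [List.nil_append, listWeight_cons]
    rw [if_pos ⟨c, hca, hlt⟩]
  | cons x L ih =>
    simp only [List.cons_append, listWeight_cons, ih]
    have : (∃ k ∈ L ++ a :: L₂, k < x) ↔ ∃ k ∈ L ++ L₂, k < x := by
      simp only [List.mem_append, List.mem_cons]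
      constructor
      · rintro ⟨k, hk | rfl | hk, hka⟩
        · exact ⟨k, .inl hk, hka⟩
        · exact ⟨c, .inr hca, hlt.trans hka⟩
        · exact ⟨k, .inr hk, hka⟩
      · rintro ⟨k, hk | hk, hka⟩
        · exact ⟨k, .inl hk, hka⟩
        · exact ⟨k, .inr (.inr hk), hka⟩
    simp only [this]
    ring

/-- A list can be cut behind a right-to-left minimum `c`: an entry left of `c` that exceeds
something in `L₂` already exceeds `c`. -/
theorem listWeight_append_cons (y t : R) (v c : V) (L₁ L₂ : List V) (h : ∀ k ∈ L₂, c ≤ k) :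
    listWeight y t v (L₁ ++ c :: L₂) =
      listWeight y t v (L₁ ++ [c]) * listWeight y t v L₂ := by
  induction L₁ with
  | nil =>
    have : ¬ ∃ k ∈ L₂, k < c := fun ⟨k, hk, hkc⟩ => absurd hkc (not_lt.2 (h k hk))
    simp [listWeight_cons, this]
  | cons x L ih =>
    simp only [List.cons_append, listWeight_cons, ih]
    have : (∃ k ∈ L ++ c :: L₂, k < x) ↔ ∃ k ∈ L ++ [c], k < x := by
      simp only [List.mem_append, List.mem_cons, List.not_mem_nil, or_false]
      constructor
      · rintro ⟨k, hk | rfl | hk, hka⟩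
        · exact ⟨k, .inl hk, hka⟩
        · exact ⟨k, .inr rfl, hka⟩
        · exact ⟨c, .inr rfl, (h k hk).trans_lt hka⟩
      · rintro ⟨k, hk | rfl, hka⟩
        · exact ⟨k, .inl hk, hka⟩
        · exact ⟨k, .inr (.inl rfl), hka⟩
    simp only [this]
    ring

/-- Each entry is either elder because of a later entry or at most `c`, so a threshold that is at
least `c` plays no role. This lets a list be moved from `i` to `N`. -/
theorem listWeight_append_singleton_congr (y t : R) {v u c : V} (L : List V) (hv : c ≤ v)
    (hu : c ≤ u) : listWeight y t v (L ++ [c]) = listWeight y t u (L ++ [c]) := by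
  induction L with
  | nil => simp [listWeight_cons, not_lt.2 hv, not_lt.2 hu]
  | cons x L ih =>
    simp only [List.cons_append, listWeight_cons, ih]
    by_cases hx : ∃ k ∈ L ++ [c], k < x
    · simp only [if_pos hx]
    · have hxc : x ≤ c := not_lt.1 fun hlt => hx ⟨c, by simp, hlt⟩
      simp only [if_neg hx, if_neg (not_lt.2 (hxc.trans hv)), if_neg (not_lt.2 (hxc.trans hu))]

/-- The positions of the entries counted by `improperCount`. -/
def improperPos (v : V) (L : List V) : Finset ℕ :=
  (Finset.range L.length).filter fun p =>
    ∀ a ∈ L[p]?, a ≤ v ∧ ∀ k ∈ L.drop (p + 1), a ≤ k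

theorem card_improperPos (v : V) (L : List V) :
    (improperPos v L).card = improperCount v L := by
  induction L with
  | nil => simp [improperPos, improperCount]
  | cons a L ih =>
    rw [improperCount, ← ih, improperPos, improperPos, List.length_cons, Finset.card_filter,
      Finset.card_filter, Finset.sum_range_succ', add_comm]
    congr 1
    simp only [List.getElem?_cons_zero, Option.mem_some_iff, zero_add, List.drop_succ_cons,
      List.drop_zero, forall_eq']
    split_ifs with h1 h2 h2
    · rcases h2 with ⟨k, hk, hka⟩ | h2
      · exact absurd hka (not_lt.2 (h1.2 k hk))
      · exact absurd h2 (not_lt.2 h1.1)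
    · rfl
    · rfl
    · push Not at h2
      exact absurd ⟨h2.2, h2.1⟩ h1

theorem mem_improperPos {v : V} {L : List V} {p : ℕ} :
    p ∈ improperPos v L ↔ ∃ L₁ a L₂, L = L₁ ++ a :: L₂ ∧ L₁.length = p ∧ a ≤ v ∧
      ∀ k ∈ L₂, a ≤ k := by
  rw [improperPos, Finset.mem_filter, Finset.mem_range]
  constructor
  · rintro ⟨hp, h⟩
    refine ⟨L.take p, L[p], L.drop (p + 1), ?_, by simp [hp.le], ?_⟩
    · rw [List.getElem_cons_drop, List.take_append_drop]
    · exact h _ (by simp [hp])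
  · rintro ⟨L₁, a, L₂, rfl, rfl, h1, h2⟩
    refine ⟨by simp, ?_⟩
    simpa using ⟨h1, h2⟩

theorem prod_update_eq_mul_erase {ι α M : Type*} [DecidableEq ι] [CommMonoid M]
    {s : Finset ι} {i : ι} (hi : i ∈ s) (F : ι → α → M) (c : ι → α) (a : α) :
    ∏ u ∈ s, F u (Function.update c i a u) = F i a * ∏ u ∈ s.erase i, F u (c u) := by
  rw [← Finset.mul_prod_erase s _ hi, Function.update_self]
  congr 1
  refine Finset.prod_congr rfl fun u hu => ?_
  rw [Function.update_of_ne (Finset.ne_of_mem_erase hu)]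

/-- The old list is added on the left because multiset subtraction is truncated; cancellation does
the rest. -/
theorem sum_update_coe_add (c : V → List V) (v : V) (l : List V) :
    ∑ u, (Function.update c v l u : Multiset V) + (c v : Multiset V) =
      ∑ u, (c u : Multiset V) + (l : Multiset V) := by
  have h := prod_update_eq_mul_erase (M := Multiplicative (Multiset V)) (Finset.mem_univ v)
    (fun _ (a : List V) => Multiplicative.ofAdd (a : Multiset V)) c l
  have h' := Finset.add_sum_erase Finset.univ (fun u => (c u : Multiset V)) (Finset.mem_univ v)
  have h2 : ∑ u, (Function.update c v l u : Multiset V)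
    = (l : Multiset V) + ∑ u ∈ Finset.univ.erase v, (c u : Multiset V) := h
  rw [h2, ← h']
  abel

end ChildLists

/-! ### The largest vertex as a leaf. -/

section Insertion

variable {V : Type} [Fintype V] [LinearOrder V]

theorem finite_isForestOn (B A : Finset V) : {c : V → List V | IsForestOn B A c}.Finite := by
  refine (Set.finite_range fun (f : V → {l : List V // l.Nodup}) v => (f v).1).subset ?_
  intro c hc
  exact ⟨fun v => ⟨c v, hc.nodup v⟩, rfl⟩

/-- The forests of `IsForestOn`. -/
noncomputable def forestsOn (B A : Finset V) : Finset (V → List V) :=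
  (finite_isForestOn B A).toFinset

@[simp] theorem mem_forestsOn {B A : Finset V} {c : V → List V} :
    c ∈ forestsOn B A ↔ IsForestOn B A c := by
  simp [forestsOn]

variable {B A : Finset V} {N : V}
variable {R : Type*} [CommSemiring R]

/-- Insert `N` into the list of `v`, behind `p` entries. -/
def insertLeaf (N : V) (c : V → List V) (v : V) (p : ℕ) : V → List V :=
  Function.update c v ((c v).take p ++ N :: (c v).drop p)

theorem mem_insertLeaf {c : V → List V} {u v w : V} {p : ℕ} :
    w ∈ insertLeaf N c v p u ↔ w ∈ c u ∨ (u = v ∧ w = N) := by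
  unfold insertLeaf
  by_cases h : u = v
  · subst h
    have : w ∈ c u ↔ w ∈ (c u).take p ∨ w ∈ (c u).drop p := by
      rw [← List.mem_append, List.take_append_drop]
    simp only [Function.update_self, List.mem_append, List.mem_cons, this, true_and]
    tauto
  · simp [h]

theorem IsForestOn.insertLeaf {c : V → List V} (hc : IsForestOn B A c) (hN : N ∉ B) (hNA : N ∉ A)
    {v : V} (hv : v ∈ B) (p : ℕ) :
    IsForestOn (insert N B) (insert N A) (insertLeaf N c v p) := by
  have hvN : v ≠ N := fun h => hN (h ▸ hv)
  refine ⟨?_, ?_, ?_⟩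
  · have h := sum_update_coe_add c v ((c v).take p ++ N :: (c v).drop p)
    have h2 : (((c v).take p ++ N :: (c v).drop p : List V) : Multiset V)
        = N ::ₘ (c v : Multiset V) := by
      rw [Multiset.cons_coe, Multiset.coe_eq_coe]
      conv_rhs => rw [← List.take_append_drop p (c v)]
      exact List.perm_middle
    rw [h2, hc.sum_eq, Multiset.add_cons, ← Multiset.cons_add] at h
    rw [Finset.insert_val_of_notMem hNA]
    exact add_right_cancel h
  · obtain ⟨f, hf⟩ := hc.ranked
    -- The new leaf takes the bottom rank, and all other ranks are shifted up to make room for it.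
    refine ⟨fun u => if u = N then 0 else f u + 1, fun u w hw => ?_⟩
    rcases mem_insertLeaf.1 hw with h | ⟨rfl, rfl⟩
    · have hw : w ≠ N := fun h' => hNA (h' ▸ hc.mem h)
      have hu : u ≠ N := by
        rintro rfl
        rw [hc.leaf _ hN] at h
        simp at h
      have := hf _ _ h
      simp [hw, hu, this]
    · simp [hvN]
  · intro u hu
    simp only [Finset.mem_insert, not_or] at hu
    have : u ≠ v := fun h => hu.2 (h ▸ hv)
    simp [_root_.insertLeaf, this, hc.leaf u hu.2]

theorem IsForestOn.minDesc_insertLeaf {c : V → List V} (hc : IsForestOn B A c) (hN : N ∉ B)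
    (hNA : N ∉ A) (hlt : ∀ v ∈ B, v < N) {v : V} (hv : v ∈ B) (p : ℕ) :
    minDesc (_root_.insertLeaf N c v p) = minDesc c := by
  have hb := isMinDesc_minDesc c
  have hbN : minDesc c N = N := by
    rcases hb.eq_or N with h | ⟨w, hw, _⟩
    · exact h
    · simp [hc.leaf N hN] at hw
  refine (hc.insertLeaf hN hNA hv p).eq_minDesc ⟨hb.le_self, fun u w hw => ?_, fun u => ?_⟩
  · rcases mem_insertLeaf.1 hw with h | ⟨rfl, rfl⟩
    · exact hb.le_child _ _ h
    · rw [hbN]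
      exact (hb.le_self _).trans (hlt _ hv).le
  · rcases hb.eq_or u with h | ⟨w, hw, h⟩
    · exact .inl h
    · exact .inr ⟨w, mem_insertLeaf.2 (.inl hw), h⟩

theorem IsForestOn.forestWeight_insertLeaf {c : V → List V} (hc : IsForestOn B A c)
    (hN : N ∉ B) (hAB : A ⊆ B) (hlt : ∀ v ∈ B, v < N) {v : V} (hv : v ∈ B) {p : ℕ}
    (hp : p ≤ (c v).length) (y t : R) :
    forestWeight y t (_root_.insertLeaf N c v p) =
      (if p = (c v).length then 1 else t) * forestWeight y t c := by
  have hNA : N ∉ A := fun h => hN (hAB h)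
  have hb := isMinDesc_minDesc c
  have hbN : minDesc c N = N := by
    rcases hb.eq_or N with h | ⟨w, hw, _⟩
    · exact h
    · simp [hc.leaf N hN] at hw
  have hbl : ∀ w ∈ c v, minDesc c w < N := fun w hw => hlt _ (hAB (hc.minDesc_mem (hc.mem hw)))
  rw [forestWeight, forestWeight, hc.minDesc_insertLeaf hN hNA hlt hv, _root_.insertLeaf,
    prod_update_eq_mul_erase (Finset.mem_univ v)
      (fun u (l : List V) => listWeight y t u (l.map (minDesc c))),
    ← Finset.mul_prod_erase Finset.univ (fun u => listWeight y t u ((c u).map (minDesc c)))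
      (Finset.mem_univ v), ← mul_assoc]
  congr 1
  split_ifs with h
  · subst h
    rw [List.take_length, List.drop_length, List.map_append, List.map_cons, List.map_nil, hbN,
      listWeight_append_max y t (hlt v hv), one_mul]
    intro a ha
    obtain ⟨w, hw, rfl⟩ := List.mem_map.1 ha
    exact (hbl w hw).le
  · have hp' : p < (c v).length := lt_of_le_of_ne hp h
    rw [List.map_append, List.map_cons, hbN,
      listWeight_insert_elder y t v (c := minDesc c (c v)[p]), ← List.map_append,
      List.take_append_drop]
    · exact List.mem_map_of_mem (List.mem_drop_iff_getElem.2 ⟨0, by simpa using hp', by simp⟩)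
    · exact hbl _ (List.getElem_mem hp')

/-- The forests in which the largest vertex `N` is a leaf. -/
theorem sum_forestWeight_leaf (hN : N ∉ B) (hAB : A ⊆ B) (hlt : ∀ v ∈ B, v < N) (y t : R) :
    ∑ c ∈ forestsOn (insert N B) (insert N A) with c N = [], forestWeight y t c =
      ∑ c ∈ forestsOn B A, ((B.card : R) + t * (A.card : R)) * forestWeight y t c := by
  have hNA : N ∉ A := fun h => hN (hAB h)
  have step : ∀ c ∈ forestsOn B A, ((B.card : R) + t * (A.card : R)) * forestWeight y t c =
      ∑ v ∈ B, ∑ p ∈ Finset.range ((c v).length + 1), forestWeight y t (insertLeaf N c v p) := by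
    intro c hc
    rw [mem_forestsOn] at hc
    -- A list of length `ℓ` has `ℓ + 1` slots, of which only the last has factor `1`. Summing the
    -- lengths over `B` then gives `|A|`.
    have h1 : ∀ v ∈ B, ∑ p ∈ Finset.range ((c v).length + 1),
        forestWeight y t (insertLeaf N c v p) =
          (1 + t * ((c v).length : R)) * forestWeight y t c := by
      intro v hv
      rw [Finset.sum_congr rfl fun p hp => hc.forestWeight_insertLeaf hN hAB hlt hv
        (Nat.lt_succ_iff.1 (Finset.mem_range.1 hp)) y t, ← Finset.sum_mul,
        Finset.sum_range_succ, if_pos rfl,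
        Finset.sum_congr rfl fun p hp => if_neg (Finset.mem_range.1 hp).ne]
      simp only [Finset.sum_const, Finset.card_range, nsmul_eq_mul]
      ring
    rw [Finset.sum_congr rfl h1, ← Finset.sum_mul, Finset.sum_add_distrib, ← Finset.mul_sum,
      ← hc.sum_length, ← Finset.sum_subset (Finset.subset_univ B)
        (fun v _ hv => by rw [hc.leaf v hv, List.length_nil])]
    simp
  rw [Finset.sum_congr rfl step]
  simp only [Finset.sum_sigma']
  symm
  refine Finset.sum_bij (fun x _ => insertLeaf N x.1 x.2.1 x.2.2) ?_ ?_ ?_ (fun _ _ => rfl)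
  · rintro ⟨c, v, p⟩ hx
    simp only [Finset.mem_sigma, mem_forestsOn, Finset.mem_range] at hx
    obtain ⟨hc, hv, -⟩ := hx
    rw [Finset.mem_filter, mem_forestsOn]
    refine ⟨hc.insertLeaf hN hNA hv p, ?_⟩
    have : N ≠ v := fun h => hN (h ▸ hv)
    simp [insertLeaf, this, hc.leaf N hN]
  · rintro ⟨c, v, p⟩ hx ⟨c', v', p'⟩ hx' heq
    simp only [Finset.mem_sigma, mem_forestsOn, Finset.mem_range] at hx hx' heq
    obtain ⟨hc, hv, hp⟩ := hx
    obtain ⟨hc', hv', hp'⟩ := hx'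
    have hvv : v = v' := by
      have h1 : N ∈ insertLeaf N c v p v := mem_insertLeaf.2 (.inr ⟨rfl, rfl⟩)
      rw [heq, mem_insertLeaf] at h1
      exact (h1.resolve_left fun h => hNA (hc'.mem h)).1
    subst hvv
    have hl := congrFun heq v
    simp only [insertLeaf, Function.update_self] at hl
    obtain ⟨h1, -, h2⟩ := (List.append_cons_inj_of_notMem
      (fun h => hNA (hc.mem (List.mem_of_mem_take h)))
      (fun h => hNA (hc.mem (List.mem_of_mem_drop h)))).1 hl
    have hpp : p = p' := by
      have := congrArg List.length h1
      simp only [List.length_take] at this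
      omega
    subst hpp
    have hcc : c = c' := by
      funext u
      by_cases hu : u = v
      · subst hu
        rw [← List.take_append_drop p (c u), h1, h2, List.take_append_drop]
      · have := congrFun heq u
        simpa [insertLeaf, hu] using this
    subst hcc
    rfl
  · intro G hG
    rw [Finset.mem_filter, mem_forestsOn] at hG
    obtain ⟨hG, hGN⟩ := hG
    obtain ⟨v, hv⟩ := hG.exists_parent (Finset.mem_insert_self N A)
    have hvN : v ≠ N := by
      rintro rfl
      simp [hGN] at hv
    have hvB : v ∈ B := by
      by_contra h
      rw [hG.leaf v (by simp [hvN, h])] at hv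
      simp at hv
    obtain ⟨l₁, l₂, hl⟩ := List.append_of_mem hv
    have hF : IsForestOn B A (Function.update G v (l₁ ++ l₂)) := by
      refine ⟨?_, ?_, ?_⟩
      · have h := sum_update_coe_add G v (l₁ ++ l₂)
        have h2 : (G v : Multiset V) = N ::ₘ ((l₁ ++ l₂ : List V) : Multiset V) := by
          rw [hl, Multiset.cons_coe, Multiset.coe_eq_coe]
          exact List.perm_middle
        rw [h2, hG.sum_eq, Finset.insert_val_of_notMem hNA, Multiset.add_cons,
          ← Multiset.cons_add, Multiset.cons_add, Multiset.cons_add, Multiset.cons_inj_right] at h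
        exact add_right_cancel h
      · obtain ⟨f, hf⟩ := hG.ranked
        refine ⟨f, fun u w hw => hf u w ?_⟩
        by_cases hu : u = v
        · subst hu
          rw [hl]
          simp only [Function.update_self, List.mem_append] at hw
          simp only [List.mem_append, List.mem_cons]
          tauto
        · simpa [hu] using hw
      · intro u hu
        have huv : u ≠ v := fun h => hu (h ▸ hvB)
        rw [Function.update_of_ne huv]
        by_cases huN : u = N
        · rw [huN, hGN]
        · exact hG.leaf u (by simp [hu, huN])
    refine ⟨⟨Function.update G v (l₁ ++ l₂), v, l₁.length⟩, ?_, ?_⟩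
    · simp only [Finset.mem_sigma, mem_forestsOn, Finset.mem_range]
      refine ⟨hF, hvB, ?_⟩
      simp
    · simp [insertLeaf, ← hl]

/-! ### The largest vertex with a single child. -/

/-- Subdivide the edge from the parent of `i` to `i` by the vertex `N`. -/
def subdivide (N : V) (c : V → List V) (i : V) : V → List V := fun v =>
  if v = N then [i] else (c v).map fun w => if w = i then N else w

theorem IsForestOn.subdivide {c : V → List V} (hc : IsForestOn B A c) (hN : N ∉ B) (hNA : N ∉ A)
    {i : V} (hi : i ∈ A) : IsForestOn (insert N B) (insert N A) (subdivide N c i) := by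
  have hiN : i ≠ N := fun h => hNA (h ▸ hi)
  refine ⟨?_, ?_, ?_⟩
  · have h1 : ∀ v, (_root_.subdivide N c i v : Multiset V) = (if v = N then {i} else 0) +
        Multiset.map (fun w => if w = i then N else w) (c v : Multiset V) := by
      intro v
      by_cases hv : v = N
      · subst hv
        simp [_root_.subdivide, hc.leaf v hN]
      · simp [_root_.subdivide, hv]
    rw [Finset.sum_congr rfl fun v _ => h1 v, Finset.sum_add_distrib,
      Finset.sum_ite_eq' Finset.univ N, if_pos (Finset.mem_univ _)]
    have h2 := map_sum (Multiset.mapAddMonoidHom fun w => if w = i then N else w)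
      (fun v => (c v : Multiset V)) Finset.univ
    simp only [Multiset.coe_mapAddMonoidHom] at h2
    rw [← h2, hc.sum_eq, Finset.insert_val_of_notMem hNA]
    have h3 : A.val = i ::ₘ (A.erase i).val := by
      rw [← Finset.insert_val_of_notMem (Finset.notMem_erase i A), Finset.insert_erase hi]
    rw [h3, Multiset.map_cons, if_pos rfl, Multiset.map_congr rfl (g := id), Multiset.map_id,
      Multiset.singleton_add, Multiset.cons_swap]
    intro x hx
    exact if_neg (Finset.ne_of_mem_erase hx)
  · obtain ⟨f, hf⟩ := hc.ranked
    -- Doubling the ranks leaves an odd value for `N` strictly between `i` and its former parent.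
    refine ⟨fun u => if u = N then 2 * f i + 1 else 2 * f u, fun u w hw => ?_⟩
    by_cases hu : u = N
    · subst hu
      simp only [_root_.subdivide, if_true, List.mem_singleton] at hw
      subst hw
      simp [hiN]
    · simp only [_root_.subdivide, hu, if_false, List.mem_map] at hw
      obtain ⟨w', hw', rfl⟩ := hw
      have h1 := hf _ _ hw'
      by_cases h : w' = i
      · subst h
        simp only [if_true, hu, if_false]
        omega
      · have : w' ≠ N := fun h' => hNA (h' ▸ hc.mem hw')
        simp only [this, h, hu, if_false]
        omega
  · intro u hu
    simp only [Finset.mem_insert, not_or] at hu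
    simp [_root_.subdivide, hu.1, hc.leaf u hu.2]

theorem IsForestOn.minDesc_subdivide {c : V → List V} (hc : IsForestOn B A c) (hN : N ∉ B)
    (hAB : A ⊆ B) (hlt : ∀ v ∈ B, v < N) {i : V} (hi : i ∈ A) :
    minDesc (_root_.subdivide N c i) = Function.update (minDesc c) N (minDesc c i) := by
  have hNA : N ∉ A := fun h => hN (hAB h)
  have hiN : i ≠ N := fun h => hNA (h ▸ hi)
  have hb := isMinDesc_minDesc c
  have key : ∀ u, u ≠ N → ∀ w ∈ c u, Function.update (minDesc c) N (minDesc c i)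
      (if w = i then N else w) = minDesc c w := by
    intro u hu w hw
    have : w ≠ N := fun h' => hNA (h' ▸ hc.mem hw)
    by_cases h : w = i <;> simp [h, this]
  refine (hc.subdivide hN hNA hi).eq_minDesc ⟨fun u => ?_, fun u w hw => ?_, fun u => ?_⟩
  · by_cases hu : u = N
    · subst hu
      simpa using (hb.le_self i).trans (hlt i (hAB hi)).le
    · simpa [hu] using hb.le_self u
  · by_cases hu : u = N
    · subst hu
      simp only [_root_.subdivide, if_true, List.mem_singleton] at hw
      subst hw
      simp [hiN]
    · simp only [_root_.subdivide, hu, if_false, List.mem_map] at hw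
      obtain ⟨w', hw', rfl⟩ := hw
      rw [key u hu w' hw', Function.update_of_ne hu]
      exact hb.le_child _ _ hw'
  · by_cases hu : u = N
    · subst hu
      exact .inr ⟨i, by simp [_root_.subdivide], by simp [hiN]⟩
    · rw [Function.update_of_ne hu]
      rcases hb.eq_or u with h | ⟨w, hw, h⟩
      · exact .inl h
      · refine .inr ⟨_, ?_, h.trans (key u hu w hw).symm⟩
        simp only [_root_.subdivide, hu, if_false]
        exact List.mem_map_of_mem hw

/-- `N` replaces `i` in the list of the former parent, and `β(N) = β(i)` because `N` exceeds all of
`B`. -/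
theorem IsForestOn.map_minDesc_subdivide {c : V → List V} (hc : IsForestOn B A c) (hN : N ∉ B)
    (hAB : A ⊆ B) (hlt : ∀ v ∈ B, v < N) {i : V} (hi : i ∈ A) {u : V} (hu : u ≠ N) :
    (_root_.subdivide N c i u).map (minDesc (_root_.subdivide N c i)) =
      (c u).map (minDesc c) := by
  have hNA : N ∉ A := fun h => hN (hAB h)
  have hiN : i ≠ N := fun h => hNA (h ▸ hi)
  rw [hc.minDesc_subdivide hN hAB hlt hi]
  simp only [_root_.subdivide, hu, if_false, List.map_map]
  refine List.map_congr_left fun w hw => ?_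
  have : w ≠ N := fun h' => hNA (h' ▸ hc.mem hw)
  by_cases h : w = i <;> simp [h, this]

/-- The only new factor comes from the edge `(N, i)`: it is improper because `i` has no sibling and
`β(i) ≤ i < N`. -/
theorem IsForestOn.forestWeight_subdivide {c : V → List V} (hc : IsForestOn B A c) (hN : N ∉ B)
    (hAB : A ⊆ B) (hlt : ∀ v ∈ B, v < N) {i : V} (hi : i ∈ A) (y t : R) :
    forestWeight y t (_root_.subdivide N c i) = y * forestWeight y t c := by
  have hNA : N ∉ A := fun h => hN (hAB h)
  have hiN : i ≠ N := fun h => hNA (h ▸ hi)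
  rw [forestWeight, forestWeight, ← Finset.mul_prod_erase _ _ (Finset.mem_univ N),
    ← Finset.mul_prod_erase _ (fun v => listWeight y t v ((c v).map (minDesc c)))
      (Finset.mem_univ N), hc.leaf N hN,
    Finset.prod_congr rfl fun u hu => by
      rw [hc.map_minDesc_subdivide hN hAB hlt hi (Finset.ne_of_mem_erase hu)]]
  have h : ¬ N < minDesc c i := not_lt.2
    (((isMinDesc_minDesc c).le_self i).trans (hlt i (hAB hi)).le)
  rw [hc.minDesc_subdivide hN hAB hlt hi]
  simp [_root_.subdivide, hiN, listWeight_cons, h]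

/-- The forests in which `i` is the only child of the largest vertex `N`. -/
theorem sum_forestsOn_single (hN : N ∉ B) (hAB : A ⊆ B) {i : V} (hi : i ∈ A)
    (f : (V → List V) → R) :
    ∑ c ∈ forestsOn (insert N B) (insert N A) with c N = [i], f c =
      ∑ c ∈ forestsOn B A, f (subdivide N c i) := by
  have hNA : N ∉ A := fun h => hN (hAB h)
  have hiN : i ≠ N := fun h => hNA (h ▸ hi)
  symm
  refine Finset.sum_bij' (fun c _ => subdivide N c i)
    (fun G _ => fun v => if v = N then [] else (G v).map fun w => if w = N then i else w)
    ?_ ?_ ?_ ?_ (fun _ _ => rfl)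
  · intro c hc
    rw [mem_forestsOn] at hc
    rw [Finset.mem_filter, mem_forestsOn]
    exact ⟨hc.subdivide hN hNA hi, by simp [subdivide]⟩
  · intro G hG
    rw [Finset.mem_filter, mem_forestsOn] at hG
    obtain ⟨hG, hGN⟩ := hG
    rw [mem_forestsOn]
    refine ⟨?_, ?_, ?_⟩
    · have h1 : ∀ v, (((if v = N then [] else (G v).map fun w => if w = N then i else w) : List V) :
          Multiset V) + (if v = N then {i} else 0) =
          Multiset.map (fun w => if w = N then i else w) (G v : Multiset V) := by
        intro v
        by_cases hv : v = N
        · subst hv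
          simp [hGN]
        · simp [hv]
      have h2 := map_sum (Multiset.mapAddMonoidHom fun w => if w = N then i else w)
        (fun v => (G v : Multiset V)) Finset.univ
      simp only [Multiset.coe_mapAddMonoidHom] at h2
      rw [hG.sum_eq, Finset.insert_val_of_notMem hNA, Multiset.map_cons, if_pos rfl,
        Multiset.map_congr rfl (g := id), Multiset.map_id, ← Finset.sum_congr rfl fun v _ => h1 v,
        Finset.sum_add_distrib, Finset.sum_ite_eq' Finset.univ N, if_pos (Finset.mem_univ _),
        ← Multiset.singleton_add, add_comm] at h2
      · exact (add_right_cancel h2).symm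
      · intro x hx
        exact if_neg (ne_of_mem_of_not_mem hx hNA)
    · obtain ⟨f, hf⟩ := hG.ranked
      refine ⟨f, fun u w hw => ?_⟩
      by_cases hu : u = N
      · simp [hu] at hw
      · simp only [hu, if_false, List.mem_map] at hw
        obtain ⟨w', hw', rfl⟩ := hw
        by_cases h : w' = N
        · subst h
          have h1 := hf w' i (by simp [hGN])
          have h2 := hf _ _ hw'
          simp only [if_true]
          omega
        · simpa [h] using hf _ _ hw'
    · intro u hu
      by_cases h : u = N
      · simp [h]
      · simp [h, hG.leaf u (by simp [h, hu])]
  · intro c hc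
    rw [mem_forestsOn] at hc
    funext v
    by_cases hv : v = N
    · subst hv
      simp [hc.leaf v hN]
    · simp only [subdivide, hv, if_false, List.map_map]
      conv_rhs => rw [← List.map_id (c v)]
      refine List.map_congr_left fun w hw => ?_
      have : w ≠ N := fun h' => hNA (h' ▸ hc.mem hw)
      by_cases h : w = i <;> simp [h, this]
  · intro G hG
    rw [Finset.mem_filter, mem_forestsOn] at hG
    obtain ⟨hG, hGN⟩ := hG
    funext v
    by_cases hv : v = N
    · subst hv
      simp [subdivide, hGN]
    · simp only [subdivide, hv, if_false, List.map_map]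
      conv_rhs => rw [← List.map_id (G v)]
      refine List.map_congr_left fun w hw => ?_
      have : w ≠ i := by
        rintro rfl
        exact hv (hG.unique hw (by simp [hGN]))
      by_cases h : w = N <;> simp [h, this]

end Insertion

/-! ### Exchanging children between the largest vertex and its last child. -/

section MoveChildren

variable {V : Type} [Fintype V] [LinearOrder V]
variable {B A : Finset V} {N : V}
variable {R : Type*} [CommSemiring R]

theorem eq_of_add_eq_add_of_add_eq_add {M : Type*} [AddCancelCommMonoid M] {s₀ s₁ s₂ a b d e : M}
    (h₂ : s₂ + a = s₁ + e) (h₁ : s₁ + b = s₀ + d) (h : a + b = d + e) : s₂ = s₀ := by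
  refine add_right_cancel (b := a + b) ?_
  rw [← add_assoc, h₂, add_right_comm, h₁, h, add_assoc]

/-- Move the first `p + 1` children of `i` to its parent `N`, to the left of `i`. -/
def moveChildren (N : V) (c : V → List V) (i : V) (p : ℕ) : V → List V :=
  Function.update (Function.update c N ((c i).take (p + 1) ++ [i])) i ((c i).drop (p + 1))

theorem moveChildren_eq {c : V → List V} {i j : V} {l₁ l₂ : List V} (hl : c i = l₁ ++ j :: l₂) :
    moveChildren N c i l₁.length =
      Function.update (Function.update c N (l₁ ++ [j, i])) i l₂ := by
  have h : c i = (l₁ ++ [j]) ++ l₂ := by simp [hl]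
  rw [moveChildren, h, List.take_left' (by simp), List.drop_left' (by simp)]
  simp

/-- For `l` the list of children that stay with `i`, this `x` is the value of `β(i)` after the move.
-/
theorem exists_min_with_list (b : V → V) (i : V) (l : List V) :
    ∃ x ≤ i, (∀ w ∈ l, x ≤ b w) ∧ (x = i ∨ ∃ w ∈ l, x = b w) := by
  induction l with
  | nil => exact ⟨i, le_rfl, by simp, .inl rfl⟩
  | cons a l ih =>
    obtain ⟨x, h1, h2, h3⟩ := ih
    refine ⟨min x (b a), (min_le_left _ _).trans h1, ?_, ?_⟩
    · intro w hw
      rcases List.mem_cons.1 hw with rfl | hw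
      · exact min_le_right _ _
      · exact (min_le_left _ _).trans (h2 w hw)
    · rcases min_choice x (b a) with h | h <;> rw [h]
      · rcases h3 with h3 | ⟨w, hw, h3⟩
        · exact .inl h3
        · exact .inr ⟨w, by simp [hw], h3⟩
      · exact .inr ⟨a, by simp, rfl⟩

theorem IsForestOn.moveChildren {c : V → List V} (hc : IsForestOn B A c) {i j : V}
    (hcN : c N = [i]) {l₁ l₂ : List V} (hl : c i = l₁ ++ j :: l₂) (hNB : N ∈ B) (hiB : i ∈ B) :
    IsForestOn B A (Function.update (Function.update c N (l₁ ++ [j, i])) i l₂) := by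
  have hiN : i ≠ N := hc.ne_of_mem (u := N) (by simp [hcN])
  refine ⟨?_, ?_, ?_⟩
  · have h1 := sum_update_coe_add c N (l₁ ++ [j, i])
    have h2 := sum_update_coe_add (Function.update c N (l₁ ++ [j, i])) i l₂
    rw [Function.update_of_ne hiN] at h2
    have h3 : (c i : Multiset V) + (c N : Multiset V) = (l₁ ++ [j, i] : List V) + (l₂ : List V) := by
      rw [hl, hcN, Multiset.coe_add, Multiset.coe_add, Multiset.coe_eq_coe]
      simp only [List.append_assoc, List.cons_append, List.nil_append]
      exact ((List.perm_append_singleton i l₂).cons j).append_left l₁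
    rw [← hc.sum_eq]
    exact eq_of_add_eq_add_of_add_eq_add h2 h1 h3
  · obtain ⟨f, hf⟩ := hc.ranked
    have hi := hf N i (by simp [hcN])
    refine ⟨f, fun u w hw => ?_⟩
    by_cases hu : u = i
    · subst hu
      rw [Function.update_self] at hw
      exact hf _ _ (by simp [hl, hw])
    · rw [Function.update_of_ne hu] at hw
      by_cases huN : u = N
      · subst huN
        rw [Function.update_self] at hw
        simp only [List.mem_append, List.mem_cons, List.not_mem_nil, or_false] at hw
        rcases hw with hw | rfl | rfl
        · exact (hf i w (by simp [hl, hw])).trans hi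
        · exact (hf i w (by simp [hl])).trans hi
        · exact hi
      · rw [Function.update_of_ne huN] at hw
        exact hf _ _ hw
  · intro u hu
    rw [Function.update_of_ne (ne_of_mem_of_not_mem hiB hu).symm,
      Function.update_of_ne (ne_of_mem_of_not_mem hNB hu).symm, hc.leaf u hu]

/-- Moving an improper child changes the smallest descendant only for its former parent. -/
theorem IsForestOn.minDesc_moveChildren {c : V → List V} (hc : IsForestOn B A c) {i j : V}
    (hcN : c N = [i]) {l₁ l₂ : List V} (hl : c i = l₁ ++ j :: l₂) (hNB : N ∈ B) (hiB : i ∈ B)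
    (hji : minDesc c j ≤ i) (hj : ∀ k ∈ l₂, minDesc c j ≤ minDesc c k) :
    ∃ x, minDesc (Function.update (Function.update c N (l₁ ++ [j, i])) i l₂) =
      Function.update (minDesc c) i x ∧ minDesc c j < x := by
  have hiN : i ≠ N := hc.ne_of_mem (u := N) (by simp [hcN])
  have hNi := hiN.symm
  have hb := isMinDesc_minDesc c
  have hG := hc.moveChildren hcN hl hNB hiB
  set b := minDesc c with hbdef
  obtain ⟨x, hx1, hx2, hx3⟩ := exists_min_with_list b i l₂
  have hjc : j ∈ c i := by simp [hl]
  have hji' : j ≠ i := hc.ne_of_mem hjc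
  have hbi : b i ≤ x := by
    rcases hx3 with rfl | ⟨w, hw, rfl⟩
    · exact hb.le_self _
    · exact hb.le_child _ _ (by simp [hl, hw])
  have hbN : b N ≤ b i := hb.le_child _ _ (by simp [hcN])
  have hjx : b j ≤ x := by
    rcases hx3 with rfl | ⟨w, hw, rfl⟩
    · exact hji
    · exact hj w hw
  have hic : ∀ u, u ≠ N → i ∉ c u := fun u hu h => hu (hc.unique h (by simp [hcN]))
  have hoff : ∀ u, u ≠ N → ∀ w ∈ c u, Function.update b i x w = b w := by
    intro u hu w hw
    exact Function.update_of_ne (ne_of_mem_of_not_mem hw (hic u hu)) _ _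
  have heq : minDesc (Function.update (Function.update c N (l₁ ++ [j, i])) i l₂) =
      Function.update b i x := by
    refine hG.eq_minDesc ⟨fun u => ?_, fun u w hw => ?_, fun u => ?_⟩
    · by_cases hu : u = i
      · subst hu; simpa using hx1
      · simpa [hu] using hb.le_self u
    · by_cases hu : u = i
      · subst hu
        rw [Function.update_self] at hw ⊢
        rw [hoff u hiN w (by simp [hl, hw])]
        exact hx2 w hw
      · rw [Function.update_of_ne hu] at hw
        rw [Function.update_of_ne hu]
        by_cases huN : u = N
        · subst huN
          rw [Function.update_self] at hw
          by_cases hwi : w = i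
          · subst hwi
            rw [Function.update_self]
            exact hbN.trans hbi
          · have hwc : w ∈ c i := by
              simp only [List.mem_append, List.mem_cons, List.not_mem_nil, or_false, hwi] at hw
              simp only [hl, List.mem_append, List.mem_cons]
              tauto
            rw [hoff i hiN w hwc]
            exact hbN.trans (hb.le_child _ _ hwc)
        · rw [Function.update_of_ne huN] at hw
          rw [hoff u huN w hw]
          exact hb.le_child _ _ hw
    · by_cases hu : u = i
      · subst hu
        simp only [Function.update_self]
        rcases hx3 with h | ⟨w, hw, h⟩
        · exact .inl h
        · exact .inr ⟨w, hw, by rw [hoff u hiN w (by simp [hl, hw]), h]⟩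
      · rw [Function.update_of_ne hu, Function.update_of_ne hu]
        by_cases huN : u = N
        · subst huN
          rw [Function.update_self]
          rcases hb.eq_or u with h | ⟨w, hw, h⟩
          · exact .inl h
          · right
            rw [hcN, List.mem_singleton] at hw
            subst hw
            -- The old minimum must be attained at a new child of `N`. A moved child in `l₁`
            -- attaining it still does; in the other cases `j` attains it, being at most `i` and at
            -- most every `β` over `l₂`.
            rcases hb.eq_or w with h' | ⟨z, hz, h'⟩
            · refine ⟨j, by simp, ?_⟩
              rw [hoff w hiN j hjc, h]
              exact le_antisymm (hb.le_child _ _ hjc) (h'.symm ▸ hji)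
            · by_cases hz1 : z ∈ l₁
              · exact ⟨z, by simp [hz1], by rw [hoff w hiN z hz, h, h']⟩
              · refine ⟨j, by simp, ?_⟩
                rw [hoff w hiN j hjc, h]
                refine le_antisymm (hb.le_child _ _ hjc) ?_
                rw [h']
                simp only [hl, List.mem_append, hz1, List.mem_cons, false_or] at hz
                rcases hz with rfl | hz
                · exact le_rfl
                · exact hj z hz
        · rw [Function.update_of_ne huN]
          rcases hb.eq_or u with h | ⟨w, hw, h⟩
          · exact .inl h
          · exact .inr ⟨w, hw, by rw [hoff u huN w hw, h]⟩
  refine ⟨x, heq, lt_of_le_of_ne hjx fun h => ?_⟩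
  -- Strictness: after the move `j` and `i` are siblings.
  refine hG.minDesc_ne (u := N) (j := j) (k := i) ?_ ?_ hji' ?_
  · simp [hNi]
  · simp [hNi]
  · rw [heq, Function.update_self, Function.update_of_ne hji', h]

/-- The list of `i` is cut behind the right-to-left minimum `β(j)`. The front part keeps its weight
under the larger threshold `N`, since it ends in `β(j) ≤ i ≤ N`. The edge `(N, i)` ends the list of
`N` and is improper before and after, contributing `y` both times. -/
theorem IsForestOn.forestWeight_moveChildren {c : V → List V} (hc : IsForestOn B A c) {i j : V}
    (hcN : c N = [i]) {l₁ l₂ : List V} (hl : c i = l₁ ++ j :: l₂) (hNB : N ∈ B) (hiB : i ∈ B)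
    (hBN : ∀ v ∈ B, v ≤ N)
    (hji : minDesc c j ≤ i) (hj : ∀ k ∈ l₂, minDesc c j ≤ minDesc c k) (y t : R) :
    forestWeight y t (Function.update (Function.update c N (l₁ ++ [j, i])) i l₂) =
      forestWeight y t c := by
  have hiN : i ≠ N := hc.ne_of_mem (u := N) (by simp [hcN])
  have hb := isMinDesc_minDesc c
  obtain ⟨x, hx, hjx⟩ := hc.minDesc_moveChildren hcN hl hNB hiB hji hj
  have hG := hc.moveChildren hcN hl hNB hiB
  have hxi : x ≤ i := by
    have := (isMinDesc_minDesc
      (Function.update (Function.update c N (l₁ ++ [j, i])) i l₂)).le_self i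
    rwa [hx, Function.update_self] at this
  have hic : ∀ u, u ≠ N → i ∉ c u := fun u hu h => hu (hc.unique h (by simp [hcN]))
  have hmap : ∀ u, u ≠ N → (c u).map (Function.update (minDesc c) i x) =
      (c u).map (minDesc c) := by
    intro u hu
    exact List.map_congr_left fun w hw =>
      Function.update_of_ne (ne_of_mem_of_not_mem hw (hic u hu)) _ _
  have hmapi := hmap i hiN
  simp only [hl, List.map_append, List.map_cons] at hmapi
  obtain ⟨h1, h2⟩ := List.append_inj hmapi (by simp)
  obtain ⟨h2, h3⟩ := List.cons_eq_cons.1 h2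
  have hNmem : N ∈ Finset.univ.erase i := Finset.mem_erase.2 ⟨hiN.symm, Finset.mem_univ _⟩
  rw [forestWeight, forestWeight, hx,
    prod_update_eq_mul_erase (Finset.mem_univ i)
      (fun u (l : List V) => listWeight y t u (l.map (Function.update (minDesc c) i x))),
    prod_update_eq_mul_erase hNmem
      (fun u (l : List V) => listWeight y t u (l.map (Function.update (minDesc c) i x))),
    Finset.prod_congr rfl fun u hu => by
      rw [hmap u (Finset.ne_of_mem_erase hu)],
    ← Finset.mul_prod_erase Finset.univ (fun u => listWeight y t u ((c u).map (minDesc c)))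
      (Finset.mem_univ i),
    ← Finset.mul_prod_erase (Finset.univ.erase i)
      (fun u => listWeight y t u ((c u).map (minDesc c))) hNmem, ← mul_assoc, ← mul_assoc]
  congr 1
  have hiN' := hBN i hiB
  simp only [hl, hcN, List.map_append, List.map_cons, List.map_nil, h1, h2, h3,
    Function.update_self]
  rw [listWeight_append_cons y t i (minDesc c j) _ _ (by simpa using hj),
    listWeight_append_cons y t N (minDesc c j) _ [x] (by simpa using hjx.le),
    listWeight_append_singleton_congr y t _ (hji.trans hiN') hji]
  have hx' : ¬ N < x := not_lt.2 (hxi.trans hiN')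
  have hi' : ¬ N < minDesc c i := not_lt.2 ((hb.le_self i).trans hiN')
  simp only [listWeight_cons, listWeight_nil, List.not_mem_nil, false_and, exists_false, if_false,
    hx', hi']
  ring

/-- Move all children of `N` but the last one to the last one. -/
theorem IsForestOn.unmoveChildren {c : V → List V} (hc : IsForestOn B A c) {i j : V}
    {l : List V} (hcN : c N = l ++ [j, i]) (hNB : N ∈ B) (hiB : i ∈ B) :
    IsForestOn B A (Function.update (Function.update c N [i]) i (l ++ j :: c i)) := by
  have hiN : i ≠ N := hc.ne_of_mem (u := N) (by simp [hcN])
  refine ⟨?_, ?_, ?_⟩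
  · have h1 := sum_update_coe_add c N [i]
    have h2 := sum_update_coe_add (Function.update c N [i]) i (l ++ j :: c i)
    rw [Function.update_of_ne hiN] at h2
    have h3 : ((l ++ j :: c i : List V) : Multiset V) + ([i] : List V)
        = (c i : Multiset V) + (c N : Multiset V) := by
      rw [hcN, Multiset.coe_add, Multiset.coe_add, Multiset.coe_eq_coe]
      refine List.Perm.trans ?_ List.perm_append_comm
      simp only [List.append_assoc, List.cons_append, List.nil_append]
      exact ((List.perm_append_singleton i (c i)).cons j).append_left l
    rw [← hc.sum_eq]
    exact eq_of_add_eq_add_of_add_eq_add h2 h1 (by rw [← h3, add_comm])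
  · obtain ⟨f, hf⟩ := hc.ranked
    have hi := hf N i (by simp [hcN])
    have key : ∀ u, u ≠ N → i ∉ c u := fun u hu h => hu (hc.unique h (by simp [hcN]))
    -- `i` must now rank above its former siblings and still below `N`. Truncation is harmless,
    -- since `f N > f i ≥ 0`.
    refine ⟨fun u => if u = i then 2 * f N - 1 else 2 * f u, fun u w hw => ?_⟩
    by_cases hu : u = i
    · subst hu
      rw [Function.update_self] at hw
      have hwu : w ≠ u ∧ f w < f N := by
        have hnd := hc.nodup N
        rw [hcN] at hnd
        simp only [List.mem_append, List.mem_cons] at hw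
        rcases hw with hw | rfl | hw
        · refine ⟨?_, hf N w (by simp [hcN, hw])⟩
          rintro rfl
          exact (List.nodup_append.1 hnd).2.2 w hw w (by simp) rfl
        · refine ⟨?_, hf N w (by simp [hcN])⟩
          rintro rfl
          simp [List.nodup_append] at hnd
        · exact ⟨hc.ne_of_mem hw, (hf _ _ hw).trans hi⟩
      simp only [hwu.1, if_true, if_false]
      omega
    · rw [Function.update_of_ne hu] at hw
      by_cases huN : u = N
      · subst huN
        rw [Function.update_self, List.mem_singleton] at hw
        subst hw
        simp only [hu, if_true, if_false]
        omega
      · rw [Function.update_of_ne huN] at hw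
        have hwi : w ≠ i := fun h => key u huN (h ▸ hw)
        have := hf _ _ hw
        simp only [hwi, hu, if_false]
        omega
  · intro u hu
    rw [Function.update_of_ne (ne_of_mem_of_not_mem hiB hu).symm,
      Function.update_of_ne (ne_of_mem_of_not_mem hNB hu).symm, hc.leaf u hu]

/-- As `β(j) < β(i)` and `N` is maximal, `β(N)` is attained neither at `N` itself nor through `i`.
It therefore comes from one of the children handed to `i`, and `β(i)` becomes the old `β(N)`. -/
theorem IsForestOn.minDesc_unmoveChildren {c : V → List V} (hc : IsForestOn B A c) {i j : V}
    {l : List V} (hcN : c N = l ++ [j, i]) (hNB : N ∈ B) (hiB : i ∈ B) (hBN : ∀ v ∈ B, v ≤ N)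
    (hji : minDesc c j < minDesc c i) :
    minDesc (Function.update (Function.update c N [i]) i (l ++ j :: c i)) =
      Function.update (minDesc c) i (minDesc c N) := by
  have hiN : i ≠ N := hc.ne_of_mem (u := N) (by simp [hcN])
  have hb := isMinDesc_minDesc c
  have hji' : j ≠ i := by rintro rfl; exact lt_irrefl _ hji
  have hnd := hc.nodup N
  rw [hcN] at hnd
  have hil : i ∉ l := by
    intro h
    exact (List.nodup_append.1 hnd).2.2 i h i (by simp) rfl
  set b := minDesc c
  have hbN : b N ≤ b i := hb.le_child _ _ (by simp [hcN])
  have hic : ∀ u, u ≠ N → i ∉ c u := fun u hu h => hu (hc.unique h (by simp [hcN]))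
  have hoff : ∀ u, u ≠ N → ∀ w ∈ c u, Function.update b i (b N) w = b w := by
    intro u hu w hw
    exact Function.update_of_ne (ne_of_mem_of_not_mem hw (hic u hu)) _ _
  refine (hc.unmoveChildren hcN hNB hiB).eq_minDesc ⟨fun u => ?_, fun u w hw => ?_, fun u => ?_⟩
  · by_cases hu : u = i
    · subst hu
      simpa using hbN.trans (hb.le_self _)
    · simpa [hu] using hb.le_self u
  · by_cases hu : u = i
    · subst hu
      rw [Function.update_self] at hw ⊢
      by_cases hwi : w ∈ c u
      · rw [hoff u hiN w hwi]
        exact hbN.trans (hb.le_child _ _ hwi)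
      · have hw' : w ∈ c N := by
          simp only [List.mem_append, List.mem_cons, hwi, or_false] at hw
          simp only [hcN, List.mem_append, List.mem_cons]
          tauto
        by_cases h : w = u
        · simp [h]
        · rw [Function.update_of_ne h]
          exact hb.le_child _ _ hw'
    · rw [Function.update_of_ne hu] at hw
      rw [Function.update_of_ne hu]
      by_cases huN : u = N
      · subst huN
        rw [Function.update_self, List.mem_singleton] at hw
        subst hw
        simp
      · rw [Function.update_of_ne huN] at hw
        rw [hoff u huN w hw]
        exact hb.le_child _ _ hw
  · by_cases hu : u = i
    · subst hu
      simp only [Function.update_self]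
      rcases hb.eq_or N with h | ⟨w, hw, h⟩
      · have h5 := (hb.le_child N j (by simp [hcN])).trans_lt (hji.trans_le (hb.le_self u))
        exact absurd (hBN u hiB) (not_le.2 (h ▸ h5))
      · have hwu : w ≠ u := by
          rintro rfl
          exact absurd (hb.le_child N j (by simp [hcN])) (not_le.2 (h ▸ hji))
        refine .inr ⟨w, ?_, by rw [Function.update_of_ne hwu, h]⟩
        simp only [hcN, List.mem_append, List.mem_cons, hwu, List.not_mem_nil, or_false] at hw
        simp only [List.mem_append, List.mem_cons]
        tauto
    · rw [Function.update_of_ne hu, Function.update_of_ne hu]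
      by_cases huN : u = N
      · subst huN
        exact .inr ⟨i, by simp, by simp⟩
      · rw [Function.update_of_ne huN]
        rcases hb.eq_or u with h | ⟨w, hw, h⟩
        · exact .inl h
        · exact .inr ⟨w, hw, by rw [hoff u huN w hw, h]⟩

end MoveChildren

/-! ### The recurrence for adding a largest vertex. -/

section Recurrence

variable {V : Type} [Fintype V] [LinearOrder V]
variable {B A : Finset V} {N : V}
variable {R : Type*} [CommSemiring R]

theorem exists_of_mem_improperPos_map {b : V → V} {v : V} {l : List V} {p : ℕ}
    (h : p ∈ improperPos v (l.map b)) :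
    ∃ l₁ j l₂, l = l₁ ++ j :: l₂ ∧ l₁.length = p ∧ b j ≤ v ∧ ∀ k ∈ l₂, b j ≤ b k := by
  obtain ⟨L₁, a, L₂, hL, hp, h1, h2⟩ := mem_improperPos.1 h
  obtain ⟨l₁, l', rfl, rfl, hl'⟩ := List.map_eq_append_iff.1 hL
  obtain ⟨j, l₂, rfl, rfl, rfl⟩ := List.map_eq_cons_iff.1 hl'
  exact ⟨l₁, j, l₂, rfl, by simpa using hp, h1, by simpa using h2⟩

/-- The number of improper edges of the forest `c`. -/
noncomputable def forestImproper (c : V → List V) : ℕ :=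
  ∑ v, improperCount v ((c v).map (minDesc c))

/-- The number of elder vertices of the forest `c`. -/
noncomputable def forestElder (c : V → List V) : ℕ :=
  ∑ v, elderCount ((c v).map (minDesc c))

theorem forestWeight_eq (y t : R) (c : V → List V) :
    forestWeight y t c = t ^ forestElder c * y ^ forestImproper c := by
  simp only [forestWeight, listWeight, Finset.prod_mul_distrib, Finset.prod_pow_eq_pow_sum,
    forestElder, forestImproper]

theorem improperCount_eq_zero {v : V} {L : List V} (h : ∀ a ∈ L, v < a) :
    improperCount v L = 0 := by
  induction L with
  | nil => rfl
  | cons a L ih =>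
    rw [improperCount, ih fun x hx => h x (by simp [hx]), if_pos (.inr (h a (by simp)))]

/-- A root precedes all non-roots, so no edge leaving a root is improper. This is needed because the
surgery reaches only improper edges that leave some `i ∈ A`. -/
theorem IsForestOn.forestImproper_eq {c : V → List V} (hc : IsForestOn B A c)
    (hroot : ∀ v ∈ B, v ∉ A → ∀ a ∈ A, v < a) :
    forestImproper c = ∑ v ∈ A, improperCount v ((c v).map (minDesc c)) := by
  symm
  refine Finset.sum_subset (Finset.subset_univ A) fun v _ hv => ?_
  by_cases hvB : v ∈ B
  · refine improperCount_eq_zero fun a ha => ?_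
    obtain ⟨w, hw, rfl⟩ := List.mem_map.1 ha
    exact hroot v hvB hv _ (hc.minDesc_mem (hc.mem hw))
  · simp [hc.leaf v hvB, improperCount]

open scoped Classical in
/-- The forests in which the last two children of the largest vertex `N` are increasing
in their smallest descendants. -/
theorem sum_forestWeight_increasing (hN : N ∉ B) (hAB : A ⊆ B) (hlt : ∀ v ∈ B, v < N)
    (hroot : ∀ v ∈ B, v ∉ A → ∀ a ∈ A, v < a) (y t : R) :
    ∑ c ∈ forestsOn (insert N B) (insert N A) with
        ∃ l j i, c N = l ++ [j, i] ∧ minDesc c j < minDesc c i, forestWeight y t c =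
      ∑ c ∈ forestsOn B A, y * (forestImproper c : R) * forestWeight y t c := by
  classical
  have hNB : N ∈ insert N B := Finset.mem_insert_self N B
  have hBN : ∀ v ∈ insert N B, v ≤ N := by
    intro v hv
    rcases Finset.mem_insert.1 hv with rfl | hv
    · exact le_rfl
    · exact (hlt v hv).le
  -- Subdividing above `i` costs a factor `y` and leaves the list of `i` and its `β`-values alone,
  -- so an improper edge leaving `i` can be chosen after the subdivision.
  have step : ∑ c ∈ forestsOn B A, y * (forestImproper c : R) * forestWeight y t c =
      ∑ i ∈ A, ∑ c ∈ forestsOn (insert N B) (insert N A) with c N = [i],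
        ∑ _p ∈ improperPos i ((c i).map (minDesc c)), forestWeight y t c := by
    have h1 : ∀ i ∈ A, ∑ c ∈ forestsOn (insert N B) (insert N A) with c N = [i],
        ∑ _p ∈ improperPos i ((c i).map (minDesc c)), forestWeight y t c =
        ∑ c ∈ forestsOn B A,
          y * (improperCount i ((c i).map (minDesc c)) : R) * forestWeight y t c := by
      intro i hi
      have hiN : i ≠ N := ne_of_mem_of_not_mem (hAB hi) hN
      rw [sum_forestsOn_single hN hAB hi fun c =>
        ∑ _p ∈ improperPos i ((c i).map (minDesc c)), forestWeight y t c]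
      refine Finset.sum_congr rfl fun c hc => ?_
      rw [mem_forestsOn] at hc
      rw [Finset.sum_const, card_improperPos, hc.map_minDesc_subdivide hN hAB hlt hi hiN,
        hc.forestWeight_subdivide hN hAB hlt hi, nsmul_eq_mul]
      ring
    rw [Finset.sum_congr rfl h1, Finset.sum_comm]
    refine Finset.sum_congr rfl fun c hc => ?_
    rw [mem_forestsOn] at hc
    rw [hc.forestImproper_eq hroot, ← Finset.sum_mul, ← Finset.mul_sum, Nat.cast_sum]
  rw [step]
  simp only [Finset.sum_sigma']
  symm
  refine Finset.sum_bij (fun x _ => moveChildren N x.2.1 x.1 x.2.2) ?_ ?_ ?_ ?_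
  · rintro ⟨i, c, p⟩ hx
    simp only [Finset.mem_sigma, Finset.mem_filter, mem_forestsOn] at hx
    obtain ⟨hi, ⟨hc, hcN⟩, hp⟩ := hx
    obtain ⟨l₁, j, l₂, hl, rfl, hji, hj⟩ := exists_of_mem_improperPos_map hp
    have hiB : i ∈ insert N B := Finset.mem_insert_of_mem (hAB hi)
    have hiN : i ≠ N := ne_of_mem_of_not_mem (hAB hi) hN
    have hji' : j ≠ i := hc.ne_of_mem (u := i) (by simp [hl])
    simp only [moveChildren_eq hl, Finset.mem_filter, mem_forestsOn]
    refine ⟨hc.moveChildren hcN hl hNB hiB, l₁, j, i, by simp [hiN.symm], ?_⟩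
    obtain ⟨x, hx, hjx⟩ := hc.minDesc_moveChildren hcN hl hNB hiB hji hj
    rw [hx, Function.update_self, Function.update_of_ne hji']
    exact hjx
  · rintro ⟨i, c, p⟩ hx ⟨i', c', p'⟩ hx' heq
    simp only [Finset.mem_sigma, Finset.mem_filter, mem_forestsOn] at hx hx' heq
    obtain ⟨hi, ⟨hc, hcN⟩, hp⟩ := hx
    obtain ⟨hi', ⟨hc', hcN'⟩, hp'⟩ := hx'
    obtain ⟨l₁, j, l₂, hl, rfl, -, -⟩ := exists_of_mem_improperPos_map hp
    obtain ⟨l₁', j', l₂', hl', rfl, -, -⟩ := exists_of_mem_improperPos_map hp'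
    have hiN : i ≠ N := ne_of_mem_of_not_mem (hAB hi) hN
    have hiN' : i' ≠ N := ne_of_mem_of_not_mem (hAB hi') hN
    rw [moveChildren_eq hl, moveChildren_eq hl'] at heq
    -- The new list of `N` is `l₁ ++ [j, i]`, from which `i`, `j` and the position can be read off.
    have h1 := congrFun heq N
    simp only [Function.update_of_ne hiN.symm, Function.update_of_ne hiN'.symm,
      Function.update_self] at h1
    obtain ⟨rfl, h2⟩ := List.append_inj' h1 (by simp)
    simp only [List.cons.injEq, and_true] at h2
    obtain ⟨rfl, rfl⟩ := h2
    have h3 := congrFun heq i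
    simp only [Function.update_self] at h3
    subst h3
    have hcc : c = c' := by
      funext u
      by_cases hu : u = i
      · rw [hu, hl, hl']
      · by_cases huN : u = N
        · rw [huN, hcN, hcN']
        · simpa [hu, huN] using congrFun heq u
    subst hcc
    rfl
  · intro G hG
    simp only [Finset.mem_filter, mem_forestsOn] at hG
    obtain ⟨hG, l, j, i, hGN, hji⟩ := hG
    have hiN : i ≠ N := hG.ne_of_mem (u := N) (by simp [hGN])
    have hji' : j ≠ i := by rintro rfl; exact lt_irrefl _ hji
    have hiA : i ∈ A := by
      have := hG.mem (v := N) (w := i) (by simp [hGN])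
      simpa [hiN] using this
    have hiB : i ∈ insert N B := Finset.mem_insert_of_mem (hAB hiA)
    have hb := isMinDesc_minDesc G
    -- The chosen improper child is `j`, which has exactly `l` to its left. It is not elder, because
    -- `β(j) < β(i)` bounds `β(j)` by the values of all old children of `i`.
    refine ⟨⟨i, Function.update (Function.update G N [i]) i (l ++ j :: G i), l.length⟩, ?_, ?_⟩
    · simp only [Finset.mem_sigma, Finset.mem_filter, mem_forestsOn]
      refine ⟨hiA, ⟨hG.unmoveChildren hGN hNB hiB, by simp [hiN.symm]⟩, ?_⟩
      rw [hG.minDesc_unmoveChildren hGN hNB hiB hBN hji, Function.update_self, mem_improperPos,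
        List.map_append, List.map_cons]
      refine ⟨_, _, _, rfl, by simp, ?_, ?_⟩
      · rw [Function.update_of_ne hji']
        exact hji.le.trans (hb.le_self i)
      · intro k hk
        obtain ⟨w, hw, rfl⟩ := List.mem_map.1 hk
        rw [Function.update_of_ne hji', Function.update_of_ne (hG.ne_of_mem hw)]
        exact hji.le.trans (hb.le_child _ _ hw)
    · have : Function.update (Function.update G N [i]) i (l ++ j :: G i) i = l ++ j :: G i := by
        simp
      simp only [moveChildren_eq this]
      funext u
      by_cases hu : u = i
      · simp [hu]
      · by_cases huN : u = N
        · simp [huN, hiN.symm, hGN]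
        · simp [hu, huN]
  · rintro ⟨i, c, p⟩ hx
    simp only [Finset.mem_sigma, Finset.mem_filter, mem_forestsOn] at hx
    obtain ⟨hi, ⟨hc, hcN⟩, hp⟩ := hx
    obtain ⟨l₁, j, l₂, hl, rfl, hji, hj⟩ := exists_of_mem_improperPos_map hp
    have hiB : i ∈ insert N B := Finset.mem_insert_of_mem (hAB hi)
    simp only [moveChildren_eq hl]
    exact (hc.forestWeight_moveChildren hcN hl hNB hiB hBN hji hj y t).symm

theorem IsForestOn.update_perm {c : V → List V} (hc : IsForestOn B A c) {v : V} {l : List V}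
    (hl : l.Perm (c v)) : IsForestOn B A (Function.update c v l) := by
  have hmem : ∀ u w, w ∈ Function.update c v l u ↔ w ∈ c u := by
    intro u w
    by_cases hu : u = v
    · subst hu
      simpa using hl.mem_iff
    · simp [hu]
  refine ⟨?_, ?_, fun u hu => ?_⟩
  · have h := sum_update_coe_add c v l
    rw [Multiset.coe_eq_coe.2 hl, hc.sum_eq] at h
    exact add_right_cancel h
  · obtain ⟨f, hf⟩ := hc.ranked
    exact ⟨f, fun u w hw => hf u w ((hmem u w).1 hw)⟩
  · refine List.eq_nil_iff_forall_not_mem.2 fun w hw => ?_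
    rw [hmem, hc.leaf u hu] at hw
    simp at hw

theorem minDesc_update_perm {c : V → List V} {v : V} {l : List V} (hl : l.Perm (c v)) :
    minDesc (Function.update c v l) = minDesc c := by
  have h : (fun a b => b ∈ Function.update c v l a) = fun a b => b ∈ c a := by
    funext u w
    by_cases hu : u = v
    · subst hu
      simpa using hl.mem_iff
    · simp [hu]
  funext u
  exact le_antisymm (minDesc_le (h ▸ minDesc_desc c u))
    (minDesc_le (h ▸ minDesc_desc (Function.update c v l) u))

/-- Exchange the last two entries of a list. -/
def swapLast {α : Type*} (l : List α) : List α :=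
  match l.reverse with
  | a :: b :: r => (b :: a :: r).reverse
  | _ => l

@[simp] theorem swapLast_append {α : Type*} (l : List α) (a b : α) :
    swapLast (l ++ [a, b]) = l ++ [b, a] := by
  simp [swapLast]

open scoped Classical in
/-- The forests in which the last two children of the largest vertex `N` are decreasing
in their smallest descendants. -/
theorem sum_forestWeight_decreasing (hBN : ∀ v ∈ B, v ≤ N) (hAB : A ⊆ B) (y t : R) :
    y * ∑ c ∈ forestsOn B A with
        ∃ l j i, c N = l ++ [i, j] ∧ minDesc c j < minDesc c i, forestWeight y t c =
      t * ∑ c ∈ forestsOn B A with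
        ∃ l j i, c N = l ++ [j, i] ∧ minDesc c j < minDesc c i, forestWeight y t c := by
  classical
  rw [Finset.mul_sum, Finset.mul_sum]
  have hperm : ∀ (l : List V) (a b : V), (l ++ [a, b]).Perm (l ++ [b, a]) :=
    fun l a b => (List.Perm.swap b a []).append_left l
  refine Finset.sum_bij' (fun c _ => Function.update c N (swapLast (c N)))
    (fun c _ => Function.update c N (swapLast (c N))) ?_ ?_ ?_ ?_ ?_
  · intro c hc
    simp only [Finset.mem_filter, mem_forestsOn] at hc ⊢
    obtain ⟨hc, l, j, i, hcN, hji⟩ := hc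
    have hp : (swapLast (c N)).Perm (c N) := by
      rw [hcN, swapLast_append]
      exact hperm _ _ _
    exact ⟨hc.update_perm hp, l, j, i, by simp [hcN], by rwa [minDesc_update_perm hp]⟩
  · intro c hc
    simp only [Finset.mem_filter, mem_forestsOn] at hc ⊢
    obtain ⟨hc, l, j, i, hcN, hji⟩ := hc
    have hp : (swapLast (c N)).Perm (c N) := by
      rw [hcN, swapLast_append]
      exact hperm _ _ _
    exact ⟨hc.update_perm hp, l, j, i, by simp [hcN], by rwa [minDesc_update_perm hp]⟩
  · intro c hc
    obtain ⟨hc, l, j, i, hcN, hji⟩ := Finset.mem_filter.1 hc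
    simp only [Function.update_self, Function.update_idem]
    rw [hcN, swapLast_append, swapLast_append, ← hcN, Function.update_eq_self]
  · intro c hc
    obtain ⟨hc, l, j, i, hcN, hji⟩ := Finset.mem_filter.1 hc
    simp only [Function.update_self, Function.update_idem]
    rw [hcN, swapLast_append, swapLast_append, ← hcN, Function.update_eq_self]
  · intro c hc
    obtain ⟨hc, l, j, i, hcN, hji⟩ := Finset.mem_filter.1 hc
    rw [mem_forestsOn] at hc
    have hp : (l ++ [j, i]).Perm (c N) := by
      rw [hcN]
      exact hperm _ _ _
    have hle : ∀ w ∈ c N, ¬ N < minDesc c w := fun w hw =>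
      not_lt.2 (hBN _ (hAB (hc.minDesc_mem (hc.mem hw))))
    have hi := hle i (by simp [hcN])
    have hj := hle j (by simp [hcN])
    simp only [hcN, swapLast_append]
    rw [forestWeight, forestWeight, minDesc_update_perm hp,
      prod_update_eq_mul_erase (Finset.mem_univ N)
        (fun u (l : List V) => listWeight y t u (l.map (minDesc c))),
      ← Finset.mul_prod_erase Finset.univ (fun u => listWeight y t u ((c u).map (minDesc c)))
        (Finset.mem_univ N), ← mul_assoc, ← mul_assoc]
    congr 1
    rw [hcN]
    simp only [List.map_append, List.map_cons, List.map_nil]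
    -- Both sides become `y * t` times the weight of the list ending in `β(j)`: before `β(j)`, the
    -- entry `β(i)` is elder; behind it, `β(i)` is last and improper.
    rw [listWeight_insert_elder y t N _ _ (List.mem_singleton_self _) hji,
      listWeight_append_cons y t N _ _ [minDesc c i] (by simpa using hji.le)]
    simp only [listWeight_cons, listWeight_nil, List.not_mem_nil, false_and, exists_false,
      if_false, hi]
    ring

/-- The weights of the forests obtained by inserting a largest vertex. The factor `y` is there
because it need not be cancellable. -/
theorem mul_sum_forestWeight_insert (hN : N ∉ B) (hAB : A ⊆ B) (hlt : ∀ v ∈ B, v < N)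
    (hroot : ∀ v ∈ B, v ∉ A → ∀ a ∈ A, v < a) (y t : R) :
    y * ∑ c ∈ forestsOn (insert N B) (insert N A), forestWeight y t c =
      y * ∑ c ∈ forestsOn B A, ((B.card : R) + (y + t) * ((A.card : R) + forestImproper c)) *
        forestWeight y t c := by
  classical
  have hBN : ∀ v ∈ insert N B, v ≤ N := by
    intro v hv
    rcases Finset.mem_insert.1 hv with rfl | hv
    · exact le_rfl
    · exact (hlt v hv).le
  have hNA : N ∉ A := fun h => hN (hAB h)
  -- The classes are: no child, one child, and at least two children with the last two increasing or
  -- decreasing. They are exhaustive because siblings have distinct `β`.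
  have split : ∑ c ∈ forestsOn (insert N B) (insert N A), forestWeight y t c =
      (∑ c ∈ forestsOn (insert N B) (insert N A) with c N = [], forestWeight y t c) +
      (∑ i ∈ A, ∑ c ∈ forestsOn (insert N B) (insert N A) with c N = [i], forestWeight y t c) +
      (∑ c ∈ forestsOn (insert N B) (insert N A) with
        ∃ l j i, c N = l ++ [j, i] ∧ minDesc c j < minDesc c i, forestWeight y t c) +
      (∑ c ∈ forestsOn (insert N B) (insert N A) with
        ∃ l j i, c N = l ++ [i, j] ∧ minDesc c j < minDesc c i, forestWeight y t c) := by
    simp only [Finset.sum_filter]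
    rw [Finset.sum_comm, ← Finset.sum_add_distrib, ← Finset.sum_add_distrib,
      ← Finset.sum_add_distrib]
    refine Finset.sum_congr rfl fun c hc => ?_
    rw [mem_forestsOn] at hc
    rcases List.eq_nil_or_concat (c N) with h | ⟨l, i, h⟩
    · simp [h]
    · rcases List.eq_nil_or_concat l with rfl | ⟨l, j, rfl⟩
      · have hi : i ∈ A := by
          have h1 := hc.mem (v := N) (w := i) (by simp [h])
          have h2 := hc.ne_of_mem (u := N) (w := i) (by simp [h])
          simpa [h2] using h1
        have hno : ∀ l a b, ¬ c N = l ++ [a, b] := by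
          intro l a b h'
          have := congrArg List.length (h.symm.trans h')
          simp at this
        have hno1 : ¬ ∃ l j i, c N = l ++ [j, i] ∧ minDesc c j < minDesc c i :=
          fun ⟨l, j, i, h', _⟩ => hno l j i h'
        have hno2 : ¬ ∃ l j i, c N = l ++ [i, j] ∧ minDesc c j < minDesc c i :=
          fun ⟨l, j, i, h', _⟩ => hno l i j h'
        rw [if_neg hno1, if_neg hno2]
        simp [h, hi]
      · have h' : c N = l ++ [j, i] := by simp [h]
        have hji : j ≠ i := by
          have hnd := hc.nodup N
          rw [h'] at hnd
          intro e
          simp [e, List.nodup_append] at hnd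
        have hinj : ∀ m a b, c N = m ++ [a, b] → a = j ∧ b = i := by
          intro m a b hm
          have := (List.append_inj' (h'.symm.trans hm) (by simp)).2
          simp only [List.cons.injEq, and_true] at this
          exact ⟨this.1.symm, this.2.symm⟩
        have h1 : (∃ l j i, c N = l ++ [j, i] ∧ minDesc c j < minDesc c i) ↔
            minDesc c j < minDesc c i := by
          constructor
          · rintro ⟨m, a, b, hm, hab⟩
            obtain ⟨rfl, rfl⟩ := hinj m a b hm
            exact hab
          · exact fun hlt => ⟨l, j, i, h', hlt⟩
        have h2 : (∃ l j i, c N = l ++ [i, j] ∧ minDesc c j < minDesc c i) ↔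
            minDesc c i < minDesc c j := by
          constructor
          · rintro ⟨m, a, b, hm, hab⟩
            obtain ⟨rfl, rfl⟩ := hinj m b a hm
            exact hab
          · exact fun hlt => ⟨l, i, j, h', hlt⟩
        have h3 : c N ≠ [] := by simp [h']
        have h4 : ∀ k, c N ≠ [k] := by
          intro k hk
          have := congrArg List.length (h'.symm.trans hk)
          simp at this
        simp only [h1, h2, if_neg h3, if_neg (h4 _), Finset.sum_const_zero, zero_add]
        rcases lt_or_gt_of_ne (hc.minDesc_ne (u := N) (j := j) (k := i) (by simp [h'])
          (by simp [h']) hji) with hlt | hlt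
        · rw [if_pos hlt, if_neg hlt.not_gt, add_zero]
        · rw [if_neg hlt.not_gt, if_pos hlt, zero_add]
  have single : ∑ i ∈ A, ∑ c ∈ forestsOn (insert N B) (insert N A) with c N = [i],
      forestWeight y t c = ∑ c ∈ forestsOn B A, y * (A.card : R) * forestWeight y t c := by
    rw [Finset.sum_congr rfl fun i hi => sum_forestsOn_single hN hAB hi (forestWeight y t),
      Finset.sum_comm]
    refine Finset.sum_congr rfl fun c hc => ?_
    rw [mem_forestsOn] at hc
    rw [Finset.sum_congr rfl fun i hi => hc.forestWeight_subdivide hN hAB hlt hi y t,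
      Finset.sum_const, nsmul_eq_mul]
    ring
  rw [split, mul_add, sum_forestWeight_decreasing hBN (Finset.insert_subset_insert N hAB),
    sum_forestWeight_increasing hN hAB hlt hroot, single, sum_forestWeight_leaf hN hAB hlt,
    ← Finset.sum_add_distrib, ← Finset.sum_add_distrib, Finset.mul_sum, Finset.mul_sum,
    Finset.mul_sum, ← Finset.sum_add_distrib]
  refine Finset.sum_congr rfl fun c _ => ?_
  ring

theorem forestsOn_empty (B : Finset V) : forestsOn B ∅ = {fun _ => []} := by
  ext c
  rw [mem_forestsOn, Finset.mem_singleton]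
  constructor
  · intro hc
    funext v
    exact List.eq_nil_iff_forall_not_mem.2 fun w hw => by simpa using hc.mem hw
  · rintro rfl
    exact ⟨by simp, ⟨fun _ => 0, by simp⟩, fun _ _ => rfl⟩

end Recurrence

/-! ### Comparison with the polynomials `Q_n`. -/

section Polynomials

/-- The generating polynomial of the forests on the first `m` elements of `Fin n` whose roots
are the first `r` ones: the variable `X` marks improper edges, `C X` marks elder vertices. -/
noncomputable def forestPoly (n r m : ℕ) : (ℤ[X])[X] :=
  ∑ c ∈ forestsOn (V := Fin n) {v | (v : ℕ) < m} {v | r ≤ (v : ℕ) ∧ (v : ℕ) < m},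
    forestWeight X (C X) c

theorem forestPoly_self (n r : ℕ) : forestPoly n r r = 1 := by
  have : ({v : Fin n | r ≤ (v : ℕ) ∧ (v : ℕ) < r} : Finset (Fin n)) = ∅ := by
    ext v
    simp
  rw [forestPoly, this, forestsOn_empty, Finset.sum_singleton]
  simp [forestWeight]

theorem forestPoly_succ {n r m : ℕ} (hrm : r ≤ m) (hmn : m < n) :
    forestPoly n r (m + 1) = (m : (ℤ[X])[X]) * forestPoly n r m +
      (X + C X) * (((m - r : ℕ) : (ℤ[X])[X]) * forestPoly n r m +
        X * derivative (forestPoly n r m)) := by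
  set B : Finset (Fin n) := {v | (v : ℕ) < m} with hB
  set A : Finset (Fin n) := {v | r ≤ (v : ℕ) ∧ (v : ℕ) < m} with hA
  set N : Fin n := ⟨m, hmn⟩
  have hB' : ({v | (v : ℕ) < m + 1} : Finset (Fin n)) = insert N B := by
    ext v
    simp [hB, N, Fin.ext_iff]
    omega
  have hA' : ({v | r ≤ (v : ℕ) ∧ (v : ℕ) < m + 1} : Finset (Fin n)) = insert N A := by
    ext v
    simp [hA, N, Fin.ext_iff]
    omega
  have hcB : B.card = m := by
    rw [hB, Fin.card_filter_val_lt]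
    omega
  have hcA : A.card = m - r := by
    have : A.map Fin.valEmbedding = Finset.Ico r m := by
      ext k
      simp only [hA, Finset.mem_map, Finset.mem_filter, Finset.mem_univ, true_and,
        Fin.valEmbedding_apply, Finset.mem_Ico]
      constructor
      · rintro ⟨a, h, rfl⟩
        exact h
      · intro h
        exact ⟨⟨k, by omega⟩, h, rfl⟩
    rw [← Nat.card_Ico, ← this, Finset.card_map]
  have hroot : ∀ v ∈ B, v ∉ A → ∀ a ∈ A, v < a := by
    intro v hv hvA a ha
    simp only [hB, hA, Finset.mem_filter, Finset.mem_univ, true_and, Fin.lt_def] at *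
    omega
  have h := mul_sum_forestWeight_insert (N := N) (B := B) (A := A) (by simp [hB, N])
    (fun v hv => by simp only [hB, hA, Finset.mem_filter, Finset.mem_univ, true_and] at *; omega)
    (fun v hv => by simpa [hB, N, Fin.lt_def] using hv) hroot (X : (ℤ[X])[X]) (C X)
  rw [← hB', ← hA'] at h
  -- With `y` an indeterminate over a domain, the auxiliary factor cancels.
  replace h := mul_left_cancel₀ X_ne_zero h
  rw [forestPoly, h, forestPoly, derivative_sum]
  simp only [Finset.mul_sum, ← Finset.sum_add_distrib]
  refine Finset.sum_congr rfl fun c _ => ?_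
  have hd : X * derivative (forestWeight (X : (ℤ[X])[X]) (C X) c) =
      (forestImproper c : (ℤ[X])[X]) * forestWeight (X : (ℤ[X])[X]) (C X) c := by
    rw [forestWeight_eq, ← C_pow, derivative_C_mul, derivative_X_pow]
    rcases Nat.eq_zero_or_pos (forestImproper c) with h0 | h0
    · simp [h0]
    · obtain ⟨k, hk⟩ := Nat.exists_eq_succ_of_ne_zero h0.ne'
      rw [hk]
      simp only [Nat.succ_eq_add_one, Nat.add_sub_cancel, pow_succ, map_natCast]
      ring
  rw [hd, hcA, hcB]
  ring

/-- The value of `chapotonQ` at `x = r`, `z = 1`. -/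
noncomputable def chapotonEval (r : ℕ) : MvPolynomial (Fin 4) ℤ →ₐ[ℤ] (ℤ[X])[X] :=
  MvPolynomial.aeval ![(r : (ℤ[X])[X]), X, 1, C X]

/-- The values substituted for `x`, `z` and `t` are constants with respect to `y`. -/
theorem chapotonEval_pderiv (r : ℕ) (q : MvPolynomial (Fin 4) ℤ) :
    chapotonEval r (MvPolynomial.pderiv 1 q) = derivative (chapotonEval r q) := by
  induction q using MvPolynomial.induction_on with
  | C a => simp [chapotonEval]
  | add p q hp hq => simp [hp, hq]
  | mul_X p i hp =>
    rw [Derivation.leibniz, map_add, smul_eq_mul, smul_eq_mul, map_mul, map_mul, map_mul, hp,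
      derivative_mul, MvPolynomial.pderiv_X]
    fin_cases i <;> simp [chapotonEval] <;> ring

/-- With `r + m + 1` vertices present, `m + 1` of them non-roots, the factor `|B|` is `x + (m + 1)
z` at `x = r`, `z = 1`. The induction starts at one non-root, because `Q` starts at index `1`. -/
theorem forestPoly_eq {n r : ℕ} (m : ℕ) (h : r + m + 1 ≤ n) :
    forestPoly n r (r + m + 1) = (r : (ℤ[X])[X]) * chapotonEval r (chapotonQ (m + 1)) := by
  induction m with
  | zero =>
    rw [forestPoly_succ (by omega) (by omega), Nat.add_zero, forestPoly_self]
    simp [chapotonQ]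
  | succ m ih =>
    rw [← add_assoc, forestPoly_succ (by omega) (by omega), ih (by omega), chapotonQ,
      show r + m + 1 - r = m + 1 by omega]
    simp only [map_add, map_mul, chapotonEval_pderiv, map_natCast]
    rw [derivative_mul, derivative_natCast]
    simp only [chapotonEval, MvPolynomial.aeval_X]
    simp
    ring

theorem aeval_chapotonQCoeff (r m k : ℕ) :
    MvPolynomial.aeval (![(r : ℤ[X]), X] : Fin 2 → ℤ[X]) (chapotonQCoeff m k) =
      (chapotonEval r (chapotonQ m)).coeff k := by
  have h : (Polynomial.mapAlgHom (MvPolynomial.aeval (![(r : ℤ[X]), X] : Fin 2 → ℤ[X]))).comp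
      (MvPolynomial.aeval (![C (MvPolynomial.X 0), X, 1, C (MvPolynomial.X 1)] :
        Fin 4 → Polynomial (MvPolynomial (Fin 2) ℤ))) = chapotonEval r := by
    ext i
    fin_cases i <;> simp [chapotonEval]
  rw [← h, chapotonQCoeff]
  simp [Polynomial.coe_mapAlgHom, Polynomial.coeff_map]

end Polynomials

/-! ### From child lists back to plane forests and their statistics. -/

section Statistics

variable {V : Type} [Fintype V] [LinearOrder V]

theorem pair_sublist_cons_iff {α : Type*} {a j k : α} {l : List α} :
    [j, k].Sublist (a :: l) ↔ [j, k].Sublist l ∨ (j = a ∧ k ∈ l) := by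
  rw [List.sublist_cons_iff]
  refine or_congr_right ⟨?_, ?_⟩
  · rintro ⟨r, hr, hs⟩
    simp only [List.cons.injEq] at hr
    obtain ⟨rfl, rfl⟩ := hr
    exact ⟨rfl, List.singleton_sublist.1 hs⟩
  · rintro ⟨rfl, hk⟩
    exact ⟨[k], rfl, List.singleton_sublist.2 hk⟩

theorem exists_pair_sublist_head_iff (b : V → V) {a : V} {l : List V} (ha : a ∉ l) :
    (∃ k, [a, k].Sublist (a :: l) ∧ b k < b a) ↔ ∃ k ∈ l.map b, k < b a := by
  constructor
  · rintro ⟨k, hk, hlt⟩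
    rcases pair_sublist_cons_iff.1 hk with h | ⟨-, h⟩
    · exact absurd (h.subset (by simp)) ha
    · exact ⟨_, List.mem_map_of_mem h, hlt⟩
  · rintro ⟨x, hx, hlt⟩
    obtain ⟨k, hk, rfl⟩ := List.mem_map.1 hx
    exact ⟨k, pair_sublist_cons_iff.2 (.inr ⟨rfl, hk⟩), hlt⟩

open scoped Classical in
theorem elderCount_map (b : V → V) {l : List V} (hl : l.Nodup) :
    elderCount (l.map b) =
      (l.toFinset.filter fun j => ∃ k, [j, k].Sublist l ∧ b k < b j).card := by
  induction l with
  | nil => simp [elderCount]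
  | cons a l ih =>
    obtain ⟨ha, hl⟩ := List.nodup_cons.1 hl
    have hcons : ∀ j ∈ l, (∃ k, [j, k].Sublist (a :: l) ∧ b k < b j) ↔
        ∃ k, [j, k].Sublist l ∧ b k < b j := by
      intro j hj
      have : j ≠ a := fun h => ha (h ▸ hj)
      simp [pair_sublist_cons_iff, this]
    have hhead := exists_pair_sublist_head_iff b ha
    rw [List.map_cons, elderCount, ih hl, List.toFinset_cons, Finset.filter_insert,
      Finset.filter_congr fun j hj => hcons j (List.mem_toFinset.1 hj)]
    simp only [hhead]
    split_ifs
    · rw [Finset.card_insert_of_notMem (by simp [ha]), add_comm]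
    · rw [zero_add]

open scoped Classical in
theorem improperCount_map (b : V → V) (v : V) {l : List V} (hl : l.Nodup) :
    improperCount v (l.map b) = (l.toFinset.filter fun j =>
      ¬ ((∃ k, [j, k].Sublist l ∧ b k < b j) ∨ v < b j)).card := by
  induction l with
  | nil => simp [improperCount]
  | cons a l ih =>
    obtain ⟨ha, hl⟩ := List.nodup_cons.1 hl
    have hcons : ∀ j ∈ l, (¬ ((∃ k, [j, k].Sublist (a :: l) ∧ b k < b j) ∨ v < b j)) ↔
        ¬ ((∃ k, [j, k].Sublist l ∧ b k < b j) ∨ v < b j) := by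
      intro j hj
      have : j ≠ a := fun h => ha (h ▸ hj)
      simp [pair_sublist_cons_iff, this]
    have hhead := exists_pair_sublist_head_iff b ha
    rw [List.map_cons, improperCount, ih hl, List.toFinset_cons, Finset.filter_insert,
      Finset.filter_congr fun j hj => hcons j (List.mem_toFinset.1 hj)]
    simp only [hhead]
    by_cases h : (∃ k ∈ l.map b, k < b a) ∨ v < b a
    · rw [if_pos h, if_neg (not_not.2 h), zero_add]
    · rw [if_neg h, if_pos h, Finset.card_insert_of_notMem (by simp [ha]), add_comm]

namespace PlaneForest

/-- Uniqueness of parents makes the sets of elder children of different vertices disjoint, so the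
local counts add up. -/
theorem eld_eq (F : PlaneForest V) : F.eld = forestElder F.children := by
  classical
  have hset : {j | F.IsElder j} = ((Finset.univ.biUnion fun i => (F.children i).toFinset.filter
      fun j => ∃ k, [j, k].Sublist (F.children i) ∧ F.beta k < F.beta j : Finset V) : Set V) := by
    ext j
    simp only [Set.mem_ofPred_eq, IsElder, Finset.coe_biUnion, Set.mem_iUnion, Finset.mem_coe,
      Finset.mem_filter, List.mem_toFinset, Finset.mem_univ, exists_prop, true_and]
    constructor
    · rintro ⟨i, k, h, hlt⟩
      exact ⟨i, h.subset (by simp), k, h, hlt⟩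
    · rintro ⟨i, -, k, h, hlt⟩
      exact ⟨i, k, h, hlt⟩
  rw [eld, hset, Set.ncard_coe_finset, Finset.card_biUnion, forestElder]
  · refine Finset.sum_congr rfl fun i _ => ?_
    rw [elderCount_map _ (F.nodup i), F.beta_eq_minDesc]
  · intro u _ v _ huv
    refine Finset.disjoint_left.2 ?_
    intro w hw hw'
    simp only [Finset.mem_filter, List.mem_toFinset] at hw hw'
    exact huv (F.parent_unique _ _ _ hw.1 hw'.1)

theorem isElder_iff (F : PlaneForest V) {i j : V} (h : j ∈ F.children i) :
    F.IsElder j ↔ ∃ k, [j, k].Sublist (F.children i) ∧ F.beta k < F.beta j := by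
  constructor
  · rintro ⟨u, k, hk, hlt⟩
    obtain rfl := F.parent_unique _ _ _ h (hk.subset (by simp))
    exact ⟨k, hk, hlt⟩
  · rintro ⟨k, hk, hlt⟩
    exact ⟨i, k, hk, hlt⟩

theorem imp_eq (F : PlaneForest V) : F.imp = forestImproper F.children := by
  classical
  have hset : {e : V × V | F.IsImproperEdge e.1 e.2} = ((Finset.univ.biUnion fun i =>
      ((F.children i).toFinset.filter fun j => ¬ ((∃ k, [j, k].Sublist (F.children i) ∧
        F.beta k < F.beta j) ∨ i < F.beta j)).image (Prod.mk i) : Finset (V × V)) :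
        Set (V × V)) := by
    ext ⟨i, j⟩
    simp only [Set.mem_ofPred_eq, IsImproperEdge, Finset.coe_biUnion, Set.mem_iUnion,
      Finset.mem_coe, Finset.mem_filter, List.mem_toFinset, Finset.mem_univ, exists_prop, true_and,
      Finset.mem_image, Prod.mk.injEq]
    constructor
    · rintro ⟨h, h'⟩
      rw [F.isElder_iff h] at h'
      exact ⟨i, j, ⟨h, h'⟩, rfl, rfl⟩
    · rintro ⟨_, _, ⟨h, h'⟩, rfl, rfl⟩
      rw [F.isElder_iff h]
      exact ⟨h, h'⟩
  rw [imp, hset, Set.ncard_coe_finset, Finset.card_biUnion, forestImproper]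
  · refine Finset.sum_congr rfl fun i _ => ?_
    rw [Finset.card_image_of_injective _ (Prod.mk_right_injective i),
      improperCount_map _ _ (F.nodup i), F.beta_eq_minDesc]
  · intro u _ v _ huv
    refine Finset.disjoint_left.2 ?_
    rintro ⟨a, b⟩ hw hw'
    simp only [Finset.mem_image, Prod.mk.injEq] at hw hw'
    obtain ⟨_, -, rfl, -⟩ := hw
    obtain ⟨_, -, rfl, -⟩ := hw'
    exact huv rfl

theorem isForestOn_children (F : PlaneForest V) {A : Finset V} (hA : ∀ v, F.IsRoot v ↔ v ∉ A) :
    IsForestOn Finset.univ A F.children := by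
  classical
  refine ⟨?_, ?_, fun v hv => absurd (Finset.mem_univ v) hv⟩
  · ext w
    rw [Multiset.count_sum', Multiset.count_eq_of_nodup A.nodup]
    simp only [Multiset.coe_count, Finset.mem_val]
    split_ifs with h
    · have : ¬ F.IsRoot w := fun h' => (hA w).1 h' h
      simp only [IsRoot, not_forall, not_not] at this
      obtain ⟨u, hu⟩ := this
      rw [Finset.sum_eq_single u, List.count_eq_one_of_mem (F.nodup u) hu]
      · intro v _ hv
        exact List.count_eq_zero.2 fun hw => hv (F.parent_unique _ _ _ hw hu)
      · simp
    · have : F.IsRoot w := (hA w).2 h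
      exact Finset.sum_eq_zero fun u _ => List.count_eq_zero.2 (this u)
  -- The rank is the number of proper descendants. It drops along an edge to `w`, since by
  -- acyclicity `w` is not a proper descendant of itself.
  · refine ⟨fun v => (Finset.univ.filter fun w =>
      Relation.TransGen (fun a b => b ∈ F.children a) v w).card, fun u w hw => ?_⟩
    refine Finset.card_lt_card (Finset.ssubset_iff_of_subset ?_ |>.2 ⟨w, ?_, ?_⟩)
    · intro x hx
      simp only [Finset.mem_filter, Finset.mem_univ, true_and] at hx ⊢
      exact .head hw hx
    · simp only [Finset.mem_filter, Finset.mem_univ, true_and]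
      exact .single hw
    · simp only [Finset.mem_filter, Finset.mem_univ, true_and]
      exact F.acyclic w

/-- The plane forest given by its lists of children. -/
def ofIsForestOn {B A : Finset V} {c : V → List V} (hc : IsForestOn B A c) : PlaneForest V where
  children := c
  nodup := hc.nodup
  parent_unique _ _ _ := hc.unique
  acyclic v h := by
    obtain ⟨f, hf⟩ := hc.ranked
    have : ∀ a b, Relation.TransGen (fun u w => w ∈ c u) a b → f b < f a := by
      intro a b h
      induction h with
      | single h => exact hf _ _ h
      | tail _ h2 ih => exact (hf _ _ h2).trans ih
    exact lt_irrefl _ (this v v h)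

end PlaneForest

theorem sum_planeForests (n r k : ℕ) :
    ∑ F ∈ planeForests n r k, (X : ℤ[X]) ^ F.eld = (forestPoly n r n).coeff k := by
  classical
  have hB : ({v : Fin n | (v : ℕ) < n} : Finset (Fin n)) = Finset.univ := by
    ext v
    simp
  rw [forestPoly, hB, finsetSum_coeff]
  have hcoeff : ∀ c : Fin n → List (Fin n), (forestWeight (X : (ℤ[X])[X]) (C X) c).coeff k =
      if forestImproper c = k then (X : ℤ[X]) ^ forestElder c else 0 := by
    intro c
    rw [forestWeight_eq, ← C_pow, coeff_C_mul, coeff_X_pow]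
    simp [eq_comm]
  simp only [hcoeff]
  rw [← Finset.sum_filter]
  refine Finset.sum_bij (fun F _ => F.children) ?_ ?_ ?_ ?_
  · intro F hF
    obtain ⟨h1, h2⟩ := (Finset.mem_filter.1 hF).2
    rw [Finset.mem_filter, mem_forestsOn, ← F.imp_eq]
    refine ⟨F.isForestOn_children fun v => ?_, h2⟩
    simp [h1]
  · intro F _ G _ h
    exact PlaneForest.ext h
  · intro c hc
    rw [Finset.mem_filter, mem_forestsOn] at hc
    obtain ⟨hc, hk⟩ := hc
    refine ⟨.ofIsForestOn hc, Finset.mem_filter.2 ⟨Finset.mem_univ _, fun v => ?_, ?_⟩, rfl⟩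
    · have hv : v ∈ ({v | r ≤ (v : ℕ) ∧ (v : ℕ) < n} : Finset (Fin n)) ↔ r ≤ (v : ℕ) := by simp
      constructor
      · intro h
        by_contra hlt
        obtain ⟨u, hu⟩ := hc.exists_parent (hv.2 (not_lt.1 hlt))
        exact h u hu
      · intro h u hu
        exact absurd (hv.1 (hc.mem hu)) (not_le.2 h)
    · rw [PlaneForest.imp_eq]
      exact hk
  · intro F _
    rw [F.eld_eq]

end Statistics

theorem theorem5p1 (n r k : ℕ) (hrn : r < n) :
    (r : Polynomial ℤ) *
        MvPolynomial.aeval (![(r : Polynomial ℤ), X] : Fin 2 → Polynomial ℤ)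
          (chapotonQCoeff (n - r) k)
      = ∑ F ∈ planeForests n r k, (X : Polynomial ℤ) ^ F.eld := by
  obtain ⟨m, rfl⟩ : ∃ m, n = r + m + 1 := ⟨n - r - 1, by omega⟩
  rw [aeval_chapotonQCoeff, sum_planeForests, forestPoly_eq m le_rfl,
    show r + m + 1 - r = m + 1 by omega, ← map_natCast (C : ℤ[X] →+* (ℤ[X])[X]), coeff_C_mul]
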